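/- Logarithms are to base $2$. The computational model is the word RAM: registers and memory cells hold words of $w=\Theta(\log n)$ bits, arithmetic and bitwise operations, comparisons and memory accesses on words take unit time, the input (the number $n$ and two strings of length $n$, one word per symbol) is in a read-only memory, the output is produced on a write-only memory, and space is the number of bits used in the additional readable and writable memory (registers included). Theorem. There is a RAM program (one program, independent of $n$, of $w$ and of the input) and a constant $c_0\ge 1$ such that for every constant $c$ there is a constant $C$ with the following property. For every $n$, every word size $w$ with $c_0(\lfloor\log n\rfloor+1)\le w\le c(\lfloor\log n\rfloor+1)$ (where $\lfloor \log n\rfloor$ is read as $0$ for $n=0$), and all strings $X,Y$ of length $n$ whose symbols are arbitrary $w$-bit words, the program halts with the length of a longest common subsequence of $X$ and $Y$ as its only output; and if $n\ge 2$, it does so within $C n^3$ steps and uses at most $$C\cdot\frac{n\log^{1.5} n}{2^{\sqrt{\log n}}}$$ bits of space. Moreover, $\frac{n\log^{1.5} n}{2^{\sqrt{\log n}}}=o(n)$, so that this is a polynomial-time exact algorithm with $o(n)$ bits of space. -/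

import Mathlib

open Filter Asymptotics

/-! ## Longest common subsequences -/

/-- `Z` is a common subsequence of `X` and `Y` (`<+` is Mathlib's `List.Sublist`: obtained by
removing some elements, keeping the order). -/
def IsCommonSubsequence {α : Type*} (Z X Y : List α) : Prop :=
  Z.Sublist X ∧ Z.Sublist Y

/-- `k` is the length of a longest common subsequence of `X` and `Y`. -/
def IsLCSLength {α : Type*} (X Y : List α) (k : ℕ) : Prop :=
  IsGreatest {l : ℕ | ∃ Z : List α, IsCommonSubsequence Z X Y ∧ Z.length = l} k

/-! ## The word RAM with read-only input and write-only output

The machine works on words of `w` bits. It has a fixed finite number of registers, a readable and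
writable work memory that is an array of words, a read-only input memory and a write-only output
memory that is filled from left to right. A program is a fixed list of instructions that does not
depend on the input or on the word size, and every instruction takes one unit of time. -/

namespace WordRAM

/-- The arithmetic and bitwise operations on words. -/
inductive Op where
  | add | sub | mul | div | mod | and | or | xor | shl | shr

/-- Evaluation of an operation on unsigned `w`-bit words; `add`, `sub`, `mul` are modulo `2 ^ w`. -/
def Op.eval {w : ℕ} : Op → BitVec w → BitVec w → BitVec w
  | .add, x, y => x + y
  | .sub, x, y => x - y
  | .mul, x, y => x * y
  | .div, x, y => x / y
  | .mod, x, y => x % y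
  | .and, x, y => x &&& y
  | .or, x, y => x ||| y
  | .xor, x, y => x ^^^ y
  | .shl, x, y => x <<< y.toNat
  | .shr, x, y => x >>> y.toNat

/-- The instructions of a machine with `r` registers. -/
inductive Instr (r : ℕ) where
  /-- `reg[d] := k` -/
  | const (d : Fin r) (k : ℕ)
  /-- `reg[d] := reg[a] o reg[b]` -/
  | op (o : Op) (d a b : Fin r)
  /-- `reg[d] := input[reg[a]]` -/
  | input (d a : Fin r)
  /-- `reg[d] := mem[reg[a]]` -/
  | load (d a : Fin r)
  /-- `mem[reg[a]] := reg[s]` -/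
  | store (a s : Fin r)
  /-- append `reg[s]` to the output -/
  | output (s : Fin r)
  /-- continue at instruction `l` -/
  | jump (l : ℕ)
  /-- continue at instruction `l` if `reg[a] = reg[b]` -/
  | jumpEq (a b : Fin r) (l : ℕ)
  /-- continue at instruction `l` if `reg[a] < reg[b]` -/
  | jumpLt (a b : Fin r) (l : ℕ)

/-- A program: a number of registers and a finite list of instructions. -/
structure Program where
  numRegs : ℕ
  code : List (Instr numRegs)

/-- The configurations of a machine with `r` registers and word size `w`. -/
structure Config (r w : ℕ) where
  /-- the index of the next instruction -/
  pc : ℕ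
  reg : Fin r → BitVec w
  mem : BitVec w → BitVec w
  /-- one more than the largest address of the work memory accessed so far
  (`0` if there was no access) -/
  used : ℕ
  out : List (BitVec w)

/-- The start configuration: everything is zero, the output is empty. -/
def Config.init (r w : ℕ) : Config r w where
  pc := 0
  reg := fun _ => 0
  mem := fun _ => 0
  used := 0
  out := []

/-- The effect of one instruction, with input memory `inp` (cells beyond the input read as zero). -/
def Instr.exec {r w : ℕ} (inp : List (BitVec w)) (c : Config r w) : Instr r → Config r w
  | .const d k =>
      { c with pc := c.pc + 1, reg := Function.update c.reg d (BitVec.ofNat w k) }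
  | .op o d a b =>
      { c with pc := c.pc + 1, reg := Function.update c.reg d (o.eval (c.reg a) (c.reg b)) }
  | .input d a =>
      { c with pc := c.pc + 1, reg := Function.update c.reg d (inp.getD (c.reg a).toNat 0) }
  | .load d a =>
      { c with
        pc := c.pc + 1
        reg := Function.update c.reg d (c.mem (c.reg a))
        used := max c.used ((c.reg a).toNat + 1) }
  | .store a s =>
      { c with
        pc := c.pc + 1
        mem := Function.update c.mem (c.reg a) (c.reg s)
        used := max c.used ((c.reg a).toNat + 1) }
  | .output s =>
      { c with pc := c.pc + 1, out := c.out ++ [c.reg s] }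
  | .jump l => { c with pc := l }
  | .jumpEq a b l => { c with pc := if c.reg a = c.reg b then l else c.pc + 1 }
  | .jumpLt a b l => { c with pc := if (c.reg a).toNat < (c.reg b).toNat then l else c.pc + 1 }

namespace Program

/-- The machine halts when the program counter leaves the program. -/
def Halted (P : Program) {w : ℕ} (c : Config P.numRegs w) : Prop :=
  P.code.length ≤ c.pc

/-- One step; a halted machine stays as it is. -/
def step (P : Program) {w : ℕ} (inp : List (BitVec w)) (c : Config P.numRegs w) :
    Config P.numRegs w :=
  match P.code[c.pc]? with
  | none => c
  | some i => i.exec inp c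

/-- The configuration after `t` steps on the input `inp`. -/
def run (P : Program) {w : ℕ} (inp : List (BitVec w)) (t : ℕ) : Config P.numRegs w :=
  (P.step inp)^[t] (Config.init P.numRegs w)

/-- The number of bits of the readable and writable memory (registers and the initial segment of
the work memory that has been accessed) up to the configuration `c`. -/
def bits (P : Program) {w : ℕ} (c : Config P.numRegs w) : ℕ :=
  w * (P.numRegs + c.used)

end Program

/-- The content of the input memory for two strings of length `n`: the number `n`, the first
string, the second string, one word for each symbol. -/
def encode {w : ℕ} (n : ℕ) (X Y : List (BitVec w)) : List (BitVec w) :=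
  BitVec.ofNat w n :: (X ++ Y)

end WordRAM

/-- The function `n log^{1.5} n / 2^{√(log n)}` with logarithms to base two. -/
noncomputable def spaceBound (n : ℕ) : ℝ :=
  n * Real.logb 2 n ^ (1.5 : ℝ) / 2 ^ Real.sqrt (Real.logb 2 n)

/-!
# Longest common subsequences in `o(n)` bits

The usual dynamic program needs a whole row of the table, hence about `n` bits. To save space, the
rows are cut into `K = 2 ^ q` strips of `b ≈ n / K` rows and the columns into `K` segments of width
`b`, where `q ≈ √(log n)`. An optimal path through the table crosses each border between two strips
in one of the `K` segments. As in Savitch's theorem, the segment in which the path crosses the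
middle of a range of strips is guessed (by trying all segments), and the upper and the lower half of
the range are treated recursively. This is a recursion of depth `q`, and each of its levels needs
just one buffer of `b` words, with lower bounds for the values of the table on one segment of one
border. So `O(q b)` words suffice, which is `O(n log^{1.5} n / 2 ^ √(log n))` bits. At the bottom of
the recursion there are `(2 K) ^ q = 2 ^ (q (q + 1)) ≤ n K` tasks, each of which runs the dynamic
program in one strip, column by column, with a memory of `b + 1` words, in `O(n b)` steps. Since
`K b = O(n)`, the time is `O(n ^ 3)`.

The recursion is unrolled: the guesses and the halves are the digits of the number `T` of a task in
base `2 K`, and `taskAt` decodes them. A buffer is cleared when the guess of its level changes.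

* Soundness (`clearBufs_bufs_le`): the buffers never exceed the true values, because `0` is a valid
  lower bound everywhere and the dynamic program preserves lower bounds (`stripTable_le`).
* Completeness (`le_bufs_of_path`): fix an optimal path. If the guesses agree with it, then the
  correct values on the path travel through the buffers; this is an induction on the number of
  levels that remain.

Both together give `bufs_final`. The algorithm is then written in a small structured language, whose
compilation to the word RAM is correct with exact step counts (`WordRAM.Exec.iterate_step`), and
verified with total correctness rules (`WordRAM.ensures_lcsCmd`). The programs are analysed over the
natural numbers; that no operation overflows is part of the rules.
-/

/-! ### The dynamic program for longest common subsequences -/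

/-- The usual dynamic program: the greatest number of matches on a monotone lattice path from
`(0, 0)` to `(r, j)`, where `mt r j` says that symbol `r` of the first string equals symbol `j` of
the second. -/
def lcsTable (mt : ℕ → ℕ → Bool) : ℕ → ℕ → ℕ
  | 0, _ => 0
  | _ + 1, 0 => 0
  | r + 1, j + 1 =>
    max (max (lcsTable mt r (j + 1)) (lcsTable mt (r + 1) j))
      (if mt r j then lcsTable mt r j + 1 else 0)

section lcsTable

variable (mt : ℕ → ℕ → Bool)

theorem lcsTable_zero_right (r : ℕ) : lcsTable mt r 0 = 0 := by
  cases r <;> simp [lcsTable]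

theorem lcsTable_zero_left (j : ℕ) : lcsTable mt 0 j = 0 := by
  simp [lcsTable]

theorem lcsTable_succ_succ (r j : ℕ) : lcsTable mt (r + 1) (j + 1) =
    max (max (lcsTable mt r (j + 1)) (lcsTable mt (r + 1) j))
      (if mt r j then lcsTable mt r j + 1 else 0) := by
  rw [lcsTable]

theorem lcsTable_le_right (r j : ℕ) : lcsTable mt r j ≤ j := by
  induction r generalizing j with
  | zero => simp [lcsTable_zero_left]
  | succ r ih =>
    induction j with
    | zero => simp [lcsTable_zero_right]
    | succ j ihj =>
      rw [lcsTable_succ_succ]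
      have := ih j
      have := ih (j + 1)
      split_ifs <;> omega

theorem lcsTable_mono_right (r : ℕ) : Monotone (lcsTable mt r) := by
  refine monotone_nat_of_le_succ fun j => ?_
  cases r with
  | zero => simp [lcsTable_zero_left]
  | succ r => rw [lcsTable_succ_succ]; omega

/-- Going back from row `r + 1` to row `r` along an optimal path, which uses at most one match in
between. -/
theorem exists_lcsTable_pred (r j : ℕ) : ∃ i ≤ j,
    lcsTable mt (r + 1) j ≤ lcsTable mt r i ∨
      (i < j ∧ mt r i = true ∧ lcsTable mt (r + 1) j ≤ lcsTable mt r i + 1) := by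
  induction j with
  | zero => exact ⟨0, le_rfl, Or.inl (by simp [lcsTable_zero_right])⟩
  | succ j ih =>
    obtain ⟨i, hi, h⟩ := ih
    rw [lcsTable_succ_succ]
    by_cases hA : lcsTable mt r (j + 1) < lcsTable mt (r + 1) j ∧
        (if mt r j then lcsTable mt r j + 1 else 0) ≤ lcsTable mt (r + 1) j
    · refine ⟨i, by omega, ?_⟩
      rcases h with h | ⟨h1, h2, h3⟩
      · left; omega
      · right; exact ⟨by omega, h2, by omega⟩
    · by_cases hB : (if mt r j then lcsTable mt r j + 1 else 0) ≤ lcsTable mt r (j + 1)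
      · exact ⟨j + 1, le_rfl, Or.inl (by omega)⟩
      · by_cases hm : mt r j = true
        · refine ⟨j, by omega, Or.inr ⟨by omega, hm, ?_⟩⟩
          rw [if_pos hm] at *
          omega
        · rw [if_neg hm] at hB; omega

/-- The columns in which some optimal path to `(R, N)` leaves the rows `0, …, R`. -/
theorem exists_optimal_path (R N : ℕ) : ∃ p : ℕ → ℕ, p R = N ∧ ∀ r < R, p r ≤ p (r + 1) ∧
    (lcsTable mt (r + 1) (p (r + 1)) ≤ lcsTable mt r (p r) ∨
      (p r < p (r + 1) ∧ mt r (p r) = true ∧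
        lcsTable mt (r + 1) (p (r + 1)) ≤ lcsTable mt r (p r) + 1)) := by
  induction R generalizing N with
  | zero => exact ⟨fun _ => N, rfl, by simp⟩
  | succ R ih =>
    obtain ⟨i, hi, h⟩ := exists_lcsTable_pred mt R N
    obtain ⟨p, hp, h'⟩ := ih i
    refine ⟨fun r => if r ≤ R then p r else N, by simp, fun r hr => ?_⟩
    rcases Nat.lt_or_ge r R with hlt | hge
    · simpa [show r ≤ R by omega, show r + 1 ≤ R by omega] using h' r hlt
    · obtain rfl : r = R := by omega
      simpa [hp] using ⟨hi, h⟩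

end lcsTable

/-- Whether symbol `r` of `X` and symbol `j` of `Y` exist and are equal. -/
def symbolMatch {α : Type*} [DecidableEq α] (X Y : List α) (r j : ℕ) : Bool :=
  decide (r < X.length ∧ j < Y.length ∧ X[r]? = Y[j]?)

theorem exists_common_length_eq_lcsTable {α : Type*} [DecidableEq α] (X Y : List α) (r j : ℕ) :
    ∃ Z, IsCommonSubsequence Z (X.take r) (Y.take j) ∧
      Z.length = lcsTable (symbolMatch X Y) r j := by
  induction r generalizing j with
  | zero => exact ⟨[], ⟨by simp, by simp⟩, by simp [lcsTable_zero_left]⟩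
  | succ r ihr =>
    induction j with
    | zero => exact ⟨[], ⟨by simp, by simp⟩, by simp [lcsTable_zero_right]⟩
    | succ j ihj =>
      have hX : (X.take r).Sublist (X.take (r + 1)) := (List.take_prefix_take_left (by omega)).sublist
      have hY : (Y.take j).Sublist (Y.take (j + 1)) := (List.take_prefix_take_left (by omega)).sublist
      rw [lcsTable_succ_succ]
      have key : ∀ a b c : ℕ, max (max a b) c = a ∨ max (max a b) c = b ∨
        (c ≠ 0 ∧ max (max a b) c = c) := by omega
      rcases key (lcsTable (symbolMatch X Y) r (j + 1)) (lcsTable (symbolMatch X Y) (r + 1) j)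
        (if symbolMatch X Y r j then lcsTable (symbolMatch X Y) r j + 1 else 0) with h | h | ⟨h0, h⟩
      · rw [h]
        obtain ⟨Z, hZ, hl⟩ := ihr (j + 1)
        exact ⟨Z, ⟨hZ.1.trans hX, hZ.2⟩, hl⟩
      · rw [h]
        obtain ⟨Z, hZ, hl⟩ := ihj
        exact ⟨Z, ⟨hZ.1, hZ.2.trans hY⟩, hl⟩
      · rw [h]
        by_cases hm : symbolMatch X Y r j = true
        · rw [if_pos hm]
          obtain ⟨Z, hZ, hl⟩ := ihr j
          simp only [symbolMatch, decide_eq_true_eq] at hm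
          obtain ⟨h1, h2, h3⟩ := hm
          rw [List.getElem?_eq_getElem h1, List.getElem?_eq_getElem h2] at h3
          have h3 := Option.some.inj h3
          refine ⟨Z ++ [X[r]], ⟨?_, ?_⟩, by simp [hl]⟩
          · rw [List.take_succ_eq_append_getElem h1]
            exact hZ.1.append_right _
          · rw [List.take_succ_eq_append_getElem h2, h3]
            exact hZ.2.append_right _
        · rw [if_neg hm] at h0; exact absurd rfl h0

theorem length_le_lcsTable {α : Type*} [DecidableEq α] (X Y : List α) (r j : ℕ) (Z : List α)
    (hZ : IsCommonSubsequence Z (X.take r) (Y.take j)) :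
    Z.length ≤ lcsTable (symbolMatch X Y) r j := by
  induction r generalizing j Z with
  | zero =>
    have := hZ.1.length_le
    simp at this; simp [this]
  | succ r ihr =>
    induction j generalizing Z with
    | zero =>
      have := hZ.2.length_le
      simp at this; simp [this]
    | succ j ihj =>
      rw [lcsTable_succ_succ]
      by_cases h1 : r < X.length
      swap
      · have := ihr (j + 1) Z ⟨by
          simpa [List.take_of_length_le (show X.length ≤ r by omega),
            List.take_of_length_le (show X.length ≤ r + 1 by omega)] using hZ.1, hZ.2⟩
        omega
      by_cases h2 : j < Y.length
      swap
      · have := ihj Z ⟨hZ.1, by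
          simpa [List.take_of_length_le (show Y.length ≤ j by omega),
            List.take_of_length_le (show Y.length ≤ j + 1 by omega)] using hZ.2⟩
        omega
      obtain ⟨hZ1, hZ2⟩ := hZ
      have hZ1' := hZ1
      have hZ2' := hZ2
      rw [List.take_succ_eq_append_getElem h1] at hZ1
      rw [List.take_succ_eq_append_getElem h2] at hZ2
      rcases List.eq_nil_or_concat Z with rfl | ⟨Z, a, rfl⟩
      · simp
      have key : ∀ (A : List α) (x : α), (Z ++ [a]).Sublist (A ++ [x]) →
          (Z ++ [a]).Sublist A ∨ (a = x ∧ Z.Sublist A) := by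
        intro A x h
        have h := h.reverse
        simp only [List.reverse_append, List.reverse_singleton, List.singleton_append] at h
        cases h with
        | cons _ h => left; simpa using h.reverse
        | cons_cons _ h => right; exact ⟨rfl, by simpa using h.reverse⟩
      simp only [List.concat_eq_append] at *
      rcases key _ _ hZ1 with h | ⟨hx, h⟩
      · have := ihr (j + 1) _ ⟨h, hZ2'⟩
        omega
      rcases key _ _ hZ2 with h' | ⟨hy, h'⟩
      · have := ihj _ ⟨hZ1', h'⟩
        omega
      have hm : symbolMatch X Y r j = true := by
        simp [symbolMatch, h1, h2, ← hx, ← hy]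
      have := ihr j _ ⟨h, h'⟩
      rw [if_pos hm, List.length_append, List.length_singleton]
      omega

theorem isLCSLength_lcsTable {α : Type*} [DecidableEq α] (X Y : List α) {r j : ℕ}
    (hr : X.length ≤ r) (hj : Y.length ≤ j) :
    IsLCSLength X Y (lcsTable (symbolMatch X Y) r j) := by
  have h1 := exists_common_length_eq_lcsTable X Y r j
  have h2 := length_le_lcsTable X Y r j
  rw [List.take_of_length_le hr, List.take_of_length_le hj] at h1 h2
  exact ⟨h1, fun l ⟨Z, hZ, hl⟩ => hl ▸ h2 Z hZ⟩

/-! ### Dynamic programming in a strip of rows -/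

/-- The dynamic program in a strip of rows whose upper border receives the lower bounds `top`:
paths may enter the strip at the upper border of each column `j ≥ 1`, with `top j` matches
collected before. -/
def stripTable (mt : ℕ → ℕ → Bool) (top : ℕ → ℕ) : ℕ → ℕ → ℕ
  | _, 0 => 0
  | 0, j + 1 => max (stripTable mt top 0 j) (top (j + 1))
  | r + 1, j + 1 =>
    max (max (stripTable mt top (r + 1) j) (stripTable mt top r (j + 1)))
      (if mt r j then stripTable mt top r j + 1 else 0)

section stripTable

variable (mt : ℕ → ℕ → Bool) (top : ℕ → ℕ)

theorem stripTable_zero_right (r : ℕ) : stripTable mt top r 0 = 0 := by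
  cases r <;> rw [stripTable]

theorem stripTable_zero_left (j : ℕ) :
    stripTable mt top 0 (j + 1) = max (stripTable mt top 0 j) (top (j + 1)) := by
  rw [stripTable]

theorem stripTable_succ_succ (r j : ℕ) : stripTable mt top (r + 1) (j + 1) =
    max (max (stripTable mt top (r + 1) j) (stripTable mt top r (j + 1)))
      (if mt r j then stripTable mt top r j + 1 else 0) := by
  rw [stripTable]

theorem stripTable_mono_right (r : ℕ) : Monotone (stripTable mt top r) := by
  refine monotone_nat_of_le_succ fun j => ?_
  cases r with
  | zero => rw [stripTable_zero_left]; omega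
  | succ r => rw [stripTable_succ_succ]; omega

/-- Lower bounds on the upper border give lower bounds in the strip. -/
theorem stripTable_le (L : ℕ) (htop : ∀ j, top j ≤ lcsTable mt L j) (r j : ℕ) :
    stripTable (fun r j => mt (L + r) j) top r j ≤ lcsTable mt (L + r) j := by
  induction r generalizing j with
  | zero =>
    induction j with
    | zero => simp [stripTable_zero_right]
    | succ j ih =>
      rw [stripTable_zero_left]
      exact max_le (ih.trans (lcsTable_mono_right mt _ (Nat.le_succ j))) (htop _)
  | succ r ihr =>
    induction j with
    | zero => simp [stripTable_zero_right]
    | succ j ih =>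
      rw [stripTable_succ_succ, ← Nat.add_assoc, lcsTable_succ_succ]
      rw [← Nat.add_assoc] at ih
      have h1 := ihr (j + 1)
      have h2 := ihr j
      split_ifs <;> omega

/-- An optimal path that enters the strip with the correct value keeps it until it leaves. -/
theorem le_stripTable_of_path {R L : ℕ} {p : ℕ → ℕ}
    (hp : ∀ r < R, p r ≤ p (r + 1) ∧
      (lcsTable mt (r + 1) (p (r + 1)) ≤ lcsTable mt r (p r) ∨
        (p r < p (r + 1) ∧ mt r (p r) = true ∧
          lcsTable mt (r + 1) (p (r + 1)) ≤ lcsTable mt r (p r) + 1)))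
    (htop : lcsTable mt L (p L) ≤ top (p L)) (r : ℕ) (hr : L + r ≤ R) :
    lcsTable mt (L + r) (p (L + r)) ≤
      stripTable (fun r j => mt (L + r) j) top r (p (L + r)) := by
  induction r with
  | zero =>
    rcases h : p L with _ | j
    · simp [lcsTable_zero_right]
    · rw [stripTable_zero_left]
      rw [h] at htop
      exact htop.trans (le_max_right _ _)
  | succ r ih =>
    have ih := ih (by omega)
    obtain ⟨h1, h2⟩ := hp (L + r) (by omega)
    rw [← Nat.add_assoc]
    rcases h : p (L + r + 1) with _ | j
    · simp [lcsTable_zero_right]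
    rw [h] at h1 h2
    rcases h2 with h2 | ⟨h2, h3, h4⟩
    · rw [stripTable_succ_succ]
      have := stripTable_mono_right (fun r j => mt (L + r) j) top r h1
      omega
    · have h5 := stripTable_mono_right (fun r j => mt (L + r) j) top (r + 1)
        (show p (L + r) + 1 ≤ j + 1 from h2)
      rw [stripTable_succ_succ _ _ r (p (L + r)), if_pos h3] at h5
      omega

end stripTable

/-! ### The schedule of the recursion -/

/-- One elementary task: propagate from the buffer `src`, which holds values for the columns of
segment `sseg`, through the rows of the strip `strip` to the buffer `tgt`, which holds values for
the columns of the segment `tseg`. -/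
structure StripTask where
  src : ℕ
  sseg : ℕ
  tgt : ℕ
  tseg : ℕ
  strip : ℕ

/-- The position in `T` of the digit that belongs to level `e`: in base `2 ^ (q + 1)`, the number
`T` has `q` digits, and level `0` has the most significant one. -/
def digitShift (q e : ℕ) : ℕ := (q - 1 - e) * (q + 1)

/-- The half (upper or lower) of the current range of strips in which task `T` lies, on level `e`:
the lowest bit of the digit. -/
def half (q e T : ℕ) : ℕ := T / 2 ^ digitShift q e % 2

/-- The guess, on level `e` in task `T`, for the segment in which the path crosses the middle of
the range of strips: the other bits of the digit. -/
def midSeg (q e T : ℕ) : ℕ := T / 2 ^ (digitShift q e + 1) % 2 ^ q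

/-- Level `e` starts with a new guess in task `T`, so that its buffer must be cleared. -/
def IsFresh (q e T : ℕ) : Prop := e < q ∧ T % 2 ^ (digitShift q e + 1) = 0

instance (q e T : ℕ) : Decidable (IsFresh q e T) := by unfold IsFresh; infer_instance

/-- The task number `T`, up to level `e`: the range of `2 ^ (q - e)` strips with number `strip`, and
the buffers and segments at its upper and lower border. Buffer `e` belongs to the middle of the range
on level `e`, buffer `q` to the lower border of the whole table (with the segment `fin`), and
buffer `q + 1` to its upper border. -/
def taskAt (q fin T : ℕ) : ℕ → StripTask
  | 0 => ⟨q + 1, 0, q, fin, 0⟩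
  | e + 1 =>
    if half q e T = 1 then
      { taskAt q fin T e with
        src := e, sseg := midSeg q e T, strip := 2 * (taskAt q fin T e).strip + 1 }
    else
      { taskAt q fin T e with
        tgt := e, tseg := midSeg q e T, strip := 2 * (taskAt q fin T e).strip }

/-- The number of the strip at whose upper border the values of buffer `e` live in task `T`. -/
def bufLine (q fin e T : ℕ) : ℕ :=
  if e < q then (2 * (taskAt q fin T e).strip + 1) * 2 ^ (q - 1 - e) else if e = q then 2 ^ q else 0

/-- The segment of the columns for which buffer `e` holds values in task `T`. -/
def bufSeg (q fin e T : ℕ) : ℕ :=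
  if e < q then midSeg q e T else if e = q then fin else 0

theorem div_two_pow_congr {T T' k m : ℕ} (h : T / 2 ^ k = T' / 2 ^ k) (hk : k ≤ m) :
    T / 2 ^ m = T' / 2 ^ m := by
  obtain ⟨d, rfl⟩ := Nat.exists_eq_add_of_le hk
  rw [pow_add, ← Nat.div_div_eq_div_mul, ← Nat.div_div_eq_div_mul, h]

theorem not_lt_mul_lt_add {x u v : ℕ} (h₁ : x * u < x * v) (h₂ : x * v < x * u + x) : False := by
  have h3 : u < v := Nat.lt_of_mul_lt_mul_left h₁
  have h4 : v < u + 1 := Nat.lt_of_mul_lt_mul_left (by rwa [Nat.mul_succ])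
  omega

/-- Up to level `e`, a task only depends on the `e` most significant digits of its number. -/
theorem taskAt_congr {q fin T T' k e : ℕ} (h : T / 2 ^ k = T' / 2 ^ k)
    (hk : k ≤ (q - e) * (q + 1)) (he : e ≤ q) : taskAt q fin T e = taskAt q fin T' e := by
  induction e with
  | zero => rfl
  | succ e ih =>
    have h1 : k ≤ digitShift q e := by
      unfold digitShift
      rwa [show q - 1 - e = q - (e + 1) by omega]
    have ih := ih (hk.trans (Nat.mul_le_mul_right _ (by omega))) (by omega)
    have h2 : half q e T = half q e T' := by
      unfold half; rw [div_two_pow_congr h h1]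
    have h3 : midSeg q e T = midSeg q e T' := by
      unfold midSeg; rw [div_two_pow_congr h (h1.trans (Nat.le_succ _))]
    rw [taskAt, taskAt, ih, h2, h3]

/-- The source and the target of a task belong to the upper and the lower border of its range of
strips, and to its segments. The source is the last level on which the task lies in the lower half,
the target the last one on which it lies in the upper half. -/
theorem taskAt_spec {q fin T e : ℕ} (he : e ≤ q) :
    (taskAt q fin T e).strip < 2 ^ e ∧
    ((taskAt q fin T e).src = q + 1 ∨
      (taskAt q fin T e).src < e ∧ half q (taskAt q fin T e).src T = 1) ∧
    ((taskAt q fin T e).tgt = q ∨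
      (taskAt q fin T e).tgt < e ∧ half q (taskAt q fin T e).tgt T ≠ 1) ∧
    bufLine q fin (taskAt q fin T e).src T = (taskAt q fin T e).strip * 2 ^ (q - e) ∧
    bufLine q fin (taskAt q fin T e).tgt T = ((taskAt q fin T e).strip + 1) * 2 ^ (q - e) ∧
    bufSeg q fin (taskAt q fin T e).src T = (taskAt q fin T e).sseg ∧
    bufSeg q fin (taskAt q fin T e).tgt T = (taskAt q fin T e).tseg := by
  induction e with
  | zero => simp [taskAt, bufLine, bufSeg]
  | succ e ih =>
    obtain ⟨h1, h2, h3, h4, h5, h6, h7⟩ := ih (by omega)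
    have hq : q - e = (q - (e + 1)) + 1 := by omega
    rw [hq, pow_succ] at h4 h5
    have hs : bufLine q fin e T =
        (2 * (taskAt q fin T e).strip + 1) * 2 ^ (q - (e + 1)) := by
      rw [bufLine, if_pos (by omega), show q - 1 - e = q - (e + 1) by omega]
    have hg : bufSeg q fin e T = midSeg q e T := by
      rw [bufSeg, if_pos (by omega)]
    by_cases hh : half q e T = 1
    · simp only [taskAt, if_pos hh]
      refine ⟨by rw [pow_succ]; omega, Or.inr ⟨by omega, hh⟩, ?_, hs, ?_, hg, h7⟩
      · rcases h3 with h3 | h3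
        · exact Or.inl h3
        · exact Or.inr ⟨by omega, h3.2⟩
      · rw [h5]; ring
    · simp only [taskAt, if_neg hh]
      refine ⟨by rw [pow_succ]; omega, ?_, Or.inr ⟨by omega, hh⟩, ?_, hs, h6, hg⟩
      · rcases h2 with h2 | h2
        · exact Or.inl h2
        · exact Or.inr ⟨by omega, h2.2⟩
      · rw [h4]; ring

theorem taskAt_src_ne_tgt {q fin T : ℕ} : (taskAt q fin T q).src ≠ (taskAt q fin T q).tgt := by
  obtain ⟨-, h2, h3, -⟩ := taskAt_spec (fin := fin) (T := T) (le_refl q)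
  intro h
  rw [h] at h2
  rcases h2 with h2 | h2 <;> rcases h3 with h3 | h3 <;> omega

theorem not_isFresh_of_half {q e T : ℕ} (h : half q e T = 1) : ¬ IsFresh q e T := by
  rintro ⟨-, h'⟩
  rw [pow_succ, Nat.mod_mul] at h'
  unfold half at h
  have : 0 < 2 ^ digitShift q e := by positivity
  rw [h] at h'
  omega

/-! ### The buffers -/

/-- The border values that the buffer `src` provides for segment `sseg`. -/
def bufTop (b : ℕ) (B : ℕ → ℕ → ℕ) (src sseg j : ℕ) : ℕ :=
  if j / b = sseg then B src (j % b) else 0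

/-- The buffers after those of the levels with a new guess have been cleared. -/
def clearBufs (q T : ℕ) (B : ℕ → ℕ → ℕ) (e o : ℕ) : ℕ := if IsFresh q e T then 0 else B e o

/-- The buffers after the task `d`. -/
def runTask (mt : ℕ → ℕ → Bool) (n b : ℕ) (d : StripTask) (B : ℕ → ℕ → ℕ) (e o : ℕ) : ℕ :=
  if e = d.tgt ∧ d.tseg * b + o ≤ n then
    max (B e o) (stripTable (fun r j => mt (d.strip * b + r) j) (bufTop b B d.src d.sseg) b
      (d.tseg * b + o))
  else B e o

/-- The buffers before task number `T`. -/
def bufs (mt : ℕ → ℕ → Bool) (n q b fin : ℕ) : ℕ → ℕ → ℕ → ℕ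
  | 0 => fun _ _ => 0
  | T + 1 => runTask mt n b (taskAt q fin T q) (clearBufs q T (bufs mt n q b fin T))

theorem bufs_succ (mt : ℕ → ℕ → Bool) (n q b fin T : ℕ) : bufs mt n q b fin (T + 1) =
    runTask mt n b (taskAt q fin T q) (clearBufs q T (bufs mt n q b fin T)) := rfl

section bufs

variable {mt : ℕ → ℕ → Bool} {n q b fin : ℕ}

/-- The position of a buffer only changes when the buffer is cleared. -/
theorem bufLine_eq_and_bufSeg_eq {e T : ℕ} (h : ¬ IsFresh q e (T + 1)) :
    bufLine q fin e (T + 1) = bufLine q fin e T ∧ bufSeg q fin e (T + 1) = bufSeg q fin e T := by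
  unfold bufLine bufSeg
  split_ifs with he
  · have h' : (T + 1) / 2 ^ (digitShift q e + 1) = T / 2 ^ (digitShift q e + 1) := by
      have : ¬ 2 ^ (digitShift q e + 1) ∣ T + 1 := fun hd => h ⟨he, Nat.mod_eq_zero_of_dvd hd⟩
      rw [Nat.succ_div, if_neg this, Nat.add_zero]
    refine ⟨?_, by unfold midSeg; rw [h']⟩
    rw [taskAt_congr h' _ he.le]
    unfold digitShift
    rw [show q - e = q - 1 - e + 1 by omega, Nat.add_mul _ 1]
    omega
  · exact ⟨rfl, rfl⟩
  · exact ⟨rfl, rfl⟩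

/-- The border values are sound if the buffers are. -/
theorem bufTop_le {B : ℕ → ℕ → ℕ} {T : ℕ}
    (hB : ∀ e o, B e o ≤ lcsTable mt (bufLine q fin e T * b) (bufSeg q fin e T * b + o)) (j : ℕ) :
    bufTop b B (taskAt q fin T q).src (taskAt q fin T q).sseg j ≤
      lcsTable mt ((taskAt q fin T q).strip * b) j := by
  obtain ⟨-, -, -, h4, -, h6, -⟩ := taskAt_spec (fin := fin) (T := T) (le_refl q)
  unfold bufTop
  split_ifs with hj
  · have := hB (taskAt q fin T q).src (j % b)
    rw [h4, h6, Nat.sub_self, pow_zero, Nat.mul_one, ← hj] at this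
    rwa [Nat.mul_comm (j / b), Nat.div_add_mod] at this
  · exact Nat.zero_le _

/-- Soundness: the buffers hold lower bounds for the true values at their positions. -/
theorem clearBufs_bufs_le (T e o : ℕ) :
    clearBufs q T (bufs mt n q b fin T) e o ≤
      lcsTable mt (bufLine q fin e T * b) (bufSeg q fin e T * b + o) := by
  induction T generalizing e o with
  | zero => simp [clearBufs, bufs]
  | succ T ih =>
    rw [clearBufs]
    split_ifs with hf
    · exact Nat.zero_le _
    · rw [(bufLine_eq_and_bufSeg_eq hf).1, (bufLine_eq_and_bufSeg_eq hf).2, bufs, runTask]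
      split_ifs with hif
      · obtain ⟨rfl, -⟩ := hif
        refine max_le (ih _ o) ?_
        obtain ⟨-, -, -, -, h5, -, h7⟩ := taskAt_spec (fin := fin) (T := T) (le_refl q)
        rw [h5, h7, Nat.sub_self, pow_zero, Nat.mul_one, Nat.succ_mul]
        exact stripTable_le mt _ _ (bufTop_le ih) _ _
      · exact ih e o

/-- The values computed in a task are bounded by the number of the column. -/
theorem stripTable_task_le (T r j : ℕ) :
    stripTable (fun r j => mt ((taskAt q fin T q).strip * b + r) j)
      (bufTop b (clearBufs q T (bufs mt n q b fin T)) (taskAt q fin T q).src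
        (taskAt q fin T q).sseg) r j ≤ j :=
  (stripTable_le mt _ _ (bufTop_le (clearBufs_bufs_le T)) r j).trans (lcsTable_le_right mt _ j)

theorem bufs_le_of_not_isFresh {T e : ℕ} (h : ¬ IsFresh q e T) (o : ℕ) :
    bufs mt n q b fin T e o ≤ bufs mt n q b fin (T + 1) e o := by
  rw [bufs, runTask]
  have : clearBufs q T (bufs mt n q b fin T) e o = bufs mt n q b fin T e o := if_neg h
  split_ifs
  · rw [this]; exact le_max_left _ _
  · rw [this]

/-- Until the next clearing, the values of a buffer do not decrease. -/
theorem bufs_mono {T₁ T₂ e : ℕ} (hT : T₁ ≤ T₂) (h : ∀ T, T₁ ≤ T → T < T₂ → ¬ IsFresh q e T) (o : ℕ) :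
    bufs mt n q b fin T₁ e o ≤ bufs mt n q b fin T₂ e o := by
  induction T₂, hT using Nat.le_induction with
  | base => exact le_rfl
  | succ T hT ih =>
    exact (ih fun T' h1 h2 => h T' h1 (by omega)).trans
      (bufs_le_of_not_isFresh (h T hT (Nat.lt_succ_self T)) o)

/-- Completeness: consider the tasks in which the digits of the levels `< e` are fixed and agree with
an optimal path `p`. If the buffer at the upper border of the range of strips has the correct value
on the path before these tasks, then the buffer at the lower border has it after them. -/
theorem le_bufs_of_path {R : ℕ} {p : ℕ → ℕ} (hR : R = 2 ^ q * b) (hn : n < R) (hpR : p R = n)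
    (hp : ∀ r < R, p r ≤ p (r + 1) ∧
      (lcsTable mt (r + 1) (p (r + 1)) ≤ lcsTable mt r (p r) ∨
        (p r < p (r + 1) ∧ mt r (p r) = true ∧
          lcsTable mt (r + 1) (p (r + 1)) ≤ lcsTable mt r (p r) + 1)))
    (l e : ℕ) (hel : e + l = q) (T : ℕ) (hT : 2 ^ (l * (q + 1)) ∣ T) (d : StripTask)
    (hd : taskAt q fin T e = d)
    (hsrc : lcsTable mt (d.strip * 2 ^ l * b) (p (d.strip * 2 ^ l * b)) ≤
      bufTop b (bufs mt n q b fin T) d.src d.sseg (p (d.strip * 2 ^ l * b)))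
    (htgt : p ((d.strip + 1) * 2 ^ l * b) / b = d.tseg) :
    lcsTable mt ((d.strip + 1) * 2 ^ l * b) (p ((d.strip + 1) * 2 ^ l * b)) ≤
      bufTop b (bufs mt n q b fin (T + 2 ^ (l * (q + 1)))) d.tgt d.tseg
        (p ((d.strip + 1) * 2 ^ l * b)) := by
  have hb : 0 < b := by
    rcases Nat.eq_zero_or_pos b with rfl | h
    · omega
    · exact h
  have hpn : ∀ r ≤ R, p r ≤ n := by
    intro r hr
    obtain ⟨k, hk⟩ := Nat.exists_eq_add_of_le hr
    induction k generalizing r with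
    | zero => rw [← hpR, hk]; rfl
    | succ k ih => exact (hp r (by omega)).1.trans (ih (r + 1) (by omega) (by omega))
  induction l generalizing e T d with
  | zero =>
    obtain rfl : e = q := by omega
    obtain ⟨h1, h2, h3, h4, h5, h6, h7⟩ := taskAt_spec (fin := fin) (T := T) (le_refl e)
    rw [hd] at h1 h2 h3 h4 h5 h6 h7
    rw [pow_zero, Nat.mul_one] at *
    have hclear : clearBufs e T (bufs mt n e b fin T) d.src = bufs mt n e b fin T d.src := by
      funext o
      refine if_neg ?_
      rcases h2 with h2 | h2
      · rintro ⟨h, -⟩; omega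
      · exact not_isFresh_of_half h2.2
    have hsrc' : lcsTable mt (d.strip * b) (p (d.strip * b)) ≤
        bufTop b (clearBufs e T (bufs mt n e b fin T)) d.src d.sseg (p (d.strip * b)) := by
      unfold bufTop at hsrc ⊢
      rwa [hclear]
    have hle : (d.strip + 1) * b ≤ R := by
      rw [hR]; exact Nat.mul_le_mul_right _ h1
    have key := le_stripTable_of_path mt _ hp hsrc' b (by rw [← Nat.succ_mul]; exact hle)
    rw [← Nat.succ_mul] at key
    have hn' := hpn _ hle
    rw [bufTop, if_pos htgt, Nat.zero_mul, pow_zero, bufs_succ, hd, runTask]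
    have hpos : d.tseg * b + p ((d.strip + 1) * b) % b = p ((d.strip + 1) * b) := by
      rw [← htgt, Nat.mul_comm]; exact Nat.div_add_mod _ _
    rw [if_pos ⟨rfl, by rw [hpos]; exact hn'⟩, hpos]
    exact key.trans (le_max_right _ _)
  | succ l ih =>
    have hel' : e + 1 + l = q := by omega
    obtain ⟨h1, h2, h3, h4, h5, h6, h7⟩ := taskAt_spec (fin := fin) (T := T) (show e ≤ q by omega)
    rw [hd] at h1 h2 h3 h4 h5 h6 h7
    set β := 2 ^ (l * (q + 1)) with hβ
    have hβ0 : 0 < β := by positivity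
    have hβs : 2 ^ ((l + 1) * (q + 1)) = β * (2 * 2 ^ q) := by
      rw [hβ, ← pow_succ', ← pow_add]; ring_nf
    rw [hβs] at hT ⊢
    have hsh : digitShift q e = l * (q + 1) := by
      unfold digitShift; rw [show q - 1 - e = l by omega]
    obtain ⟨u, hu⟩ := hT
    set K := 2 ^ q with hK
    have hK0 : 0 < K := by positivity
    set s := d.strip with hs
    -- the segment in which the path crosses the middle of the range
    set m := p ((2 * s + 1) * 2 ^ l * b) / b with hm
    have hmidle : (2 * s + 1) * 2 ^ l * b ≤ R := by
      rw [hR]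
      refine Nat.mul_le_mul_right _ ?_
      calc (2 * s + 1) * 2 ^ l ≤ (2 * 2 ^ e) * 2 ^ l := Nat.mul_le_mul_right _ (by omega)
        _ = 2 ^ (e + 1 + l) := by ring
        _ = 2 ^ q := by rw [hel']
    have hmK : m < K := by
      refine (Nat.div_lt_iff_lt_mul hb).2 ?_
      rw [← hR]
      exact (hpn _ hmidle).trans_lt hn
    have hsame : ∀ T', T ≤ T' → T' < T + β * (2 * K) → taskAt q fin T' e = d := by
      intro T' hT1 hT2
      rw [← hd]
      refine taskAt_congr (k := (l + 1) * (q + 1)) ?_ (Nat.mul_le_mul_right _ (by omega)) (by omega)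
      rw [hβs, hu, Nat.mul_div_cancel_left _ (by positivity)]
      refine Nat.div_eq_of_lt_le (by rw [Nat.mul_comm]; omega) ?_
      rw [Nat.succ_mul, Nat.mul_comm u]; omega
    have hhalf : ∀ i, i < 2 → half q e (T + (2 * m + i) * β) = i := by
      intro i hi
      unfold half
      rw [hsh, ← hβ, hu, show β * (2 * K) * u + (2 * m + i) * β = β * (2 * (K * u + m) + i) by ring,
        Nat.mul_div_cancel_left _ hβ0]
      omega
    have hmid : ∀ i, i < 2 → midSeg q e (T + (2 * m + i) * β) = m := by
      intro i hi
      unfold midSeg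
      rw [hsh, pow_succ, ← hβ, ← Nat.div_div_eq_div_mul, hu,
        show β * (2 * K) * u + (2 * m + i) * β = β * (2 * (K * u + m) + i) by ring,
        Nat.mul_div_cancel_left _ hβ0, show (2 * (K * u + m) + i) / 2 = K * u + m by omega,
        Nat.mul_add_mod, Nat.mod_eq_of_lt hmK]
    have hlt : ∀ i, i < 2 → (2 * m + i) * β + β ≤ β * (2 * K) := by
      intro i hi
      rw [← Nat.succ_mul, Nat.mul_comm]
      exact Nat.mul_le_mul_left _ (by omega)
    have htask0 := taskAt.eq_2 q fin (T + (2 * m + 0) * β) e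
    rw [hsame _ (by omega) (by have := hlt 0 (by omega); omega), hhalf 0 (by omega),
      hmid 0 (by omega), if_neg (by omega)] at htask0
    have htask1 := taskAt.eq_2 q fin (T + (2 * m + 1) * β) e
    rw [hsame _ (by omega) (by have := hlt 1 (by omega); omega), hhalf 1 (by omega),
      hmid 1 (by omega), if_pos rfl] at htask1
    have hdvd : ∀ i, β ∣ T + (2 * m + i) * β := fun i =>
      (Dvd.intro (2 * K * u) (by rw [hu, Nat.mul_assoc β])).add (Dvd.intro_left _ rfl)
    have e1 : 2 * s * 2 ^ l = s * 2 ^ (l + 1) := by ring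
    have e2 : (2 * s + 1 + 1) * 2 ^ l = (s + 1) * 2 ^ (l + 1) := by ring
    have first := ih (e + 1) hel' _ (hdvd 0) _ htask0 (by
      simp only [← hs, e1]
      refine hsrc.trans ?_
      unfold bufTop
      split_ifs with hseg
      · refine bufs_mono (by omega) (fun T' hT1 hT2 => ?_) _
        have := hlt 0 (by omega)
        have hT' := hsame T' hT1 (by omega)
        have := (taskAt_spec (fin := fin) (T := T') (show e ≤ q by omega)).2.1
        rw [hT'] at this
        rcases this with h | h
        · rintro ⟨h', -⟩; omega
        · exact not_isFresh_of_half h.2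
      · exact Nat.zero_le _) (by simp only [← hs, ← hm])
    have second := ih (e + 1) hel' _ (hdvd 1) _ htask1 (by
      have hT1 : T + (2 * m + 0) * β + β = T + (2 * m + 1) * β := by ring
      rw [hT1] at first
      simpa only [← hs] using first) (by simp only [← hs, e2]; exact htgt)
    simp only [← hs, e2] at second
    refine second.trans ?_
    unfold bufTop
    rw [if_pos htgt, if_pos htgt]
    have := hlt 1 (by omega)
    refine bufs_mono (by omega) (fun T' hT1 hT2 hf => ?_) _
    -- a new guess on a level above can only begin at multiples of `2 ^ ((l + 1) * (q + 1))`
    rcases h3 with h3 | h3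
    · exact absurd hf.1 (by omega)
    · have hdv : β * (2 * K) ∣ T' := by
        refine (Dvd.dvd.trans ?_ (Nat.dvd_of_mod_eq_zero hf.2))
        rw [← hβs]
        refine pow_dvd_pow 2 (le_trans ?_ (Nat.le_succ _))
        exact Nat.mul_le_mul_right _ (by omega)
      obtain ⟨v, rfl⟩ := hdv
      rw [hu] at hT1 hT2
      refine not_lt_mul_lt_add ?_ hT2
      have : 0 ≤ (2 * m + 1) * β := Nat.zero_le _
      omega

/-- After all tasks, buffer `q` holds the value at the lower right corner of the table. -/
theorem bufs_final (hn : n < 2 ^ q * b) (hfin : fin = n / b) :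
    bufs mt n q b fin (2 ^ (q * (q + 1))) q (n % b) = lcsTable mt (2 ^ q * b) n := by
  apply le_antisymm
  · have := clearBufs_bufs_le (mt := mt) (n := n) (q := q) (b := b) (fin := fin)
      (2 ^ (q * (q + 1))) q (n % b)
    rw [clearBufs, if_neg (by rintro ⟨h, -⟩; omega), bufLine, if_neg (by omega), if_pos rfl, bufSeg,
      if_neg (by omega), if_pos rfl, hfin, Nat.mul_comm (n / b), Nat.div_add_mod] at this
    rwa [hfin]
  · obtain ⟨p, hpR, hp⟩ := exists_optimal_path mt (2 ^ q * b) n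
    have := le_bufs_of_path (fin := fin) rfl hn hpR hp q 0 (by omega) 0 (dvd_zero _) _ rfl
      (by simp [taskAt, lcsTable_zero_left]) (by simp [taskAt, hpR, hfin])
    simpa [taskAt, hpR, bufTop, hfin] using this

end bufs

namespace WordRAM

/-! ### A structured language over the word RAM -/

/-- The value of an operation on natural numbers, without overflow. -/
def Op.natEval : Op → ℕ → ℕ → ℕ
  | .add, x, y => x + y
  | .sub, x, y => x - y
  | .mul, x, y => x * y
  | .div, x, y => x / y
  | .mod, x, y => x % y
  | .and, x, y => x &&& y
  | .or, x, y => x ||| y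
  | .xor, x, y => x ^^^ y
  | .shl, x, y => x * 2 ^ y
  | .shr, x, y => x / 2 ^ y

/-- The operation neither overflows nor underflows on words of `w` bits. -/
def Op.NoOverflow (w : ℕ) : Op → ℕ → ℕ → Prop
  | .add, x, y => x + y < 2 ^ w
  | .sub, x, y => y ≤ x
  | .mul, x, y => x * y < 2 ^ w
  | .shl, x, y => x * 2 ^ y < 2 ^ w
  | _, _, _ => True

theorem Op.toNat_eval {w : ℕ} (o : Op) (x y : BitVec w) (h : o.NoOverflow w x.toNat y.toNat) :
    (o.eval x y).toNat = o.natEval x.toNat y.toNat := by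
  cases o <;> simp only [Op.eval, Op.natEval, Op.NoOverflow] at h ⊢
  · rw [BitVec.toNat_add, Nat.mod_eq_of_lt h]
  · exact BitVec.toNat_sub_of_le h
  · rw [BitVec.toNat_mul, Nat.mod_eq_of_lt h]
  · exact BitVec.toNat_udiv
  · exact BitVec.toNat_umod
  · exact BitVec.toNat_and ..
  · exact BitVec.toNat_or ..
  · exact BitVec.toNat_xor ..
  · rw [BitVec.toNat_shiftLeft, Nat.shiftLeft_eq, Nat.mod_eq_of_lt h]
  · rw [BitVec.toNat_ushiftRight, Nat.shiftRight_eq_div_pow]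

/-- The instructions without jumps and output. -/
inductive Prim (r : ℕ) where
  | const (d : Fin r) (k : ℕ)
  | op (o : Op) (d a b : Fin r)
  | input (d a : Fin r)
  | load (d a : Fin r)
  | store (a s : Fin r)

/-- The machine instruction for an instruction of the structured language. -/
def Prim.toInstr {r : ℕ} : Prim r → Instr r
  | .const d k => .const d k
  | .op o d a b => .op o d a b
  | .input d a => .input d a
  | .load d a => .load d a
  | .store a s => .store a s

/-- Registers and work memory, read as natural numbers. -/
structure NatState (r : ℕ) where
  reg : Fin r → ℕ
  mem : ℕ → ℕ

variable {r w : ℕ}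

/-- Assignment to a register. -/
def NatState.set (s : NatState r) (d : Fin r) (v : ℕ) : NatState r :=
  { s with reg := Function.update s.reg d v }

theorem NatState.reg_set (s : NatState r) (d : Fin r) (v : ℕ) (d' : Fin r) :
    (s.set d v).reg d' = if d' = d then v else s.reg d' := by
  simp [NatState.set, Function.update_apply]

theorem NatState.mem_set (s : NatState r) (d : Fin r) (v : ℕ) : (s.set d v).mem = s.mem := rfl

/-- Assignment to a memory cell. -/
def NatState.write (s : NatState r) (a v : ℕ) : NatState r :=
  { s with mem := Function.update s.mem a v }

theorem NatState.reg_write (s : NatState r) (a v : ℕ) : (s.write a v).reg = s.reg := rfl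

theorem NatState.mem_write (s : NatState r) (a v a' : ℕ) :
    (s.write a v).mem a' = if a' = a then v else s.mem a' := by
  simp [NatState.write, Function.update_apply]

/-- The number in a cell of the input memory. -/
def inputAt (inp : List (BitVec w)) (a : ℕ) : ℕ := (inp.getD a 0).toNat

/-- The effect of an instruction. -/
def Prim.run (inp : List (BitVec w)) (s : NatState r) : Prim r → NatState r
  | .const d k => s.set d k
  | .op o d a b => s.set d (o.natEval (s.reg a) (s.reg b))
  | .input d a => s.set d (inputAt inp (s.reg a))
  | .load d a => s.set d (s.mem (s.reg a))
  | .store a v => s.write (s.reg a) (s.reg v)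

/-- The instruction does not overflow and accesses the work memory only below the address `M`. -/
def Prim.Ok (w M : ℕ) (s : NatState r) : Prim r → Prop
  | .const _ k => k < 2 ^ w
  | .op o _ a b => o.NoOverflow w (s.reg a) (s.reg b)
  | .input _ _ => True
  | .load _ a => s.reg a < M
  | .store a _ => s.reg a < M

/-- The register that the instruction writes. -/
def Prim.writes : Prim r → Fin r → Bool
  | .const d _, v => v == d
  | .op _ d _ _, v => v == d
  | .input d _, v => v == d
  | .load d _, v => v == d
  | .store _ _, _ => false

/-- Structured programs. -/
inductive Cmd (r : ℕ) where
  | block (l : List (Prim r))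
  | seq (c₁ c₂ : Cmd r)
  | ifEq (a b : Fin r) (c : Cmd r)
  | ifLt (a b : Fin r) (c : Cmd r)
  | whileLt (a b : Fin r) (c : Cmd r)

/-- The registers that a structured program may write. -/
def Cmd.writes : Cmd r → Fin r → Bool
  | .block l, v => l.any fun p => p.writes v
  | .seq c₁ c₂, v => c₁.writes v || c₂.writes v
  | .ifEq _ _ c, v => c.writes v
  | .ifLt _ _ c, v => c.writes v
  | .whileLt _ _ c, v => c.writes v

/-- `Exec inp M c s t s'`: from `s`, the program `c` terminates in `s'` after `t` machine steps,
without overflow, and accesses the work memory only below the address `M`. -/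
inductive Exec (inp : List (BitVec w)) (M : ℕ) : Cmd r → NatState r → ℕ → NatState r → Prop
  | nil {s} : Exec inp M (.block []) s 0 s
  | cons {p l s t s'} : p.Ok w M s → Exec inp M (.block l) (p.run inp s) t s' →
      Exec inp M (.block (p :: l)) s (t + 1) s'
  | seq {c₁ c₂ s t₁ s₁ t₂ s₂} : Exec inp M c₁ s t₁ s₁ → Exec inp M c₂ s₁ t₂ s₂ →
      Exec inp M (.seq c₁ c₂) s (t₁ + t₂) s₂
  | ifEq_true {a b c s t s'} : s.reg a = s.reg b → Exec inp M c s t s' →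
      Exec inp M (.ifEq a b c) s (1 + t) s'
  | ifEq_false {a b c s} : s.reg a ≠ s.reg b → Exec inp M (.ifEq a b c) s 2 s
  | ifLt_true {a b c s t s'} : s.reg a < s.reg b → Exec inp M c s t s' →
      Exec inp M (.ifLt a b c) s (1 + t) s'
  | ifLt_false {a b c s} : ¬ s.reg a < s.reg b → Exec inp M (.ifLt a b c) s 2 s
  | while_true {a b c s t₁ s₁ t₂ s₂} : s.reg a < s.reg b → Exec inp M c s t₁ s₁ →
      Exec inp M (.whileLt a b c) s₁ t₂ s₂ →
      Exec inp M (.whileLt a b c) s (1 + (t₁ + (1 + t₂))) s₂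
  | while_false {a b c s} : ¬ s.reg a < s.reg b → Exec inp M (.whileLt a b c) s 2 s

theorem Prim.reg_run_of_not_writes {inp : List (BitVec w)} {p : Prim r} {s : NatState r} {v : Fin r}
    (h : p.writes v = false) : (p.run inp s).reg v = s.reg v := by
  cases p <;> simp_all [Prim.writes, Prim.run, NatState.reg_set, NatState.reg_write]

theorem Exec.reg_eq {inp : List (BitVec w)} {M : ℕ} {c : Cmd r} {s s' : NatState r} {t : ℕ}
    (h : Exec inp M c s t s') {v : Fin r} (hv : c.writes v = false) : s'.reg v = s.reg v := by
  induction h with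
  | nil => rfl
  | cons _ _ ih =>
    simp only [Cmd.writes, List.any_cons, Bool.or_eq_false_iff] at hv
    rw [ih hv.2, Prim.reg_run_of_not_writes hv.1]
  | seq _ _ ih₁ ih₂ =>
    simp only [Cmd.writes, Bool.or_eq_false_iff] at hv
    rw [ih₂ hv.2, ih₁ hv.1]
  | ifEq_true _ _ ih => exact ih hv
  | ifEq_false _ => rfl
  | ifLt_true _ _ ih => exact ih hv
  | ifLt_false _ => rfl
  | while_true _ _ _ ih₁ ih₂ => rw [ih₂ hv, ih₁ hv]
  | while_false _ => rfl

/-! ### Compilation -/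

/-- The number of instructions of the compiled program. -/
def Cmd.size : Cmd r → ℕ
  | .block l => l.length
  | .seq c₁ c₂ => c₁.size + c₂.size
  | .ifEq _ _ c => c.size + 2
  | .ifLt _ _ c => c.size + 2
  | .whileLt _ _ c => c.size + 3

/-- The machine code of a structured program, to be placed at the index `off`. -/
def Cmd.compile : Cmd r → ℕ → List (Instr r)
  | .block l, _ => l.map Prim.toInstr
  | .seq c₁ c₂, off => c₁.compile off ++ c₂.compile (off + c₁.size)
  | .ifEq a b c, off =>
    [.jumpEq a b (off + 2), .jump (off + (c.size + 2))] ++ c.compile (off + 2)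
  | .ifLt a b c, off =>
    [.jumpLt a b (off + 2), .jump (off + (c.size + 2))] ++ c.compile (off + 2)
  | .whileLt a b c, off =>
    [.jumpLt a b (off + 2), .jump (off + (c.size + 3))] ++ (c.compile (off + 2) ++ [.jump off])

theorem Cmd.length_compile (c : Cmd r) (off : ℕ) : (c.compile off).length = c.size := by
  induction c generalizing off with
  | block l => simp [compile, size]
  | seq c₁ c₂ ih₁ ih₂ => simp [compile, size, ih₁, ih₂]
  | ifEq a b c ih => simp [compile, size, ih]
  | ifLt a b c ih => simp [compile, size, ih]
  | whileLt a b c ih => simp [compile, size, ih]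

/-- The list `l` stands in `code` from the index `off` on. -/
def CodeAt {α : Type*} (code : List α) (off : ℕ) (l : List α) : Prop :=
  ∀ i (h : i < l.length), code[off + i]? = some l[i]

theorem codeAt_append {α : Type*} {code : List α} {off : ℕ} {l₁ l₂ : List α} :
    CodeAt code off (l₁ ++ l₂) ↔ CodeAt code off l₁ ∧ CodeAt code (off + l₁.length) l₂ := by
  constructor
  · intro h
    constructor
    · intro i hi
      rw [h i (by simp; omega), List.getElem_append_left hi]
    · intro i hi
      rw [Nat.add_assoc, h (l₁.length + i) (by simp; omega),
        List.getElem_append_right (by omega)]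
      simp
  · rintro ⟨h₁, h₂⟩ i hi
    rcases Nat.lt_or_ge i l₁.length with hlt | hge
    · rw [h₁ i hlt, List.getElem_append_left hlt]
    · have := h₂ (i - l₁.length) (by simp at hi; omega)
      rw [List.getElem_append_right hge, ← this]
      congr 1
      omega

theorem codeAt_cons {α : Type*} {code : List α} {off : ℕ} {x : α} {l : List α} :
    CodeAt code off (x :: l) ↔ code[off]? = some x ∧ CodeAt code (off + 1) l := by
  rw [← List.singleton_append, codeAt_append]
  refine and_congr_left fun _ => ⟨fun h => by simpa using h 0 (by simp), fun h i hi => ?_⟩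
  obtain rfl : i = 0 := by simpa using hi
  simpa using h

/-- The machine configuration `c` represents the state `s`. -/
structure Represents (M : ℕ) (s : NatState r) (c : Config r w) : Prop where
  reg : ∀ d, (c.reg d).toNat = s.reg d
  mem : ∀ a, (c.mem a).toNat = s.mem a.toNat
  used : c.used ≤ M

theorem Prim.represents_exec {inp : List (BitVec w)} {M : ℕ} {p : Prim r} {s : NatState r}
    {c : Config r w} (hs : Represents M s c) (hp : p.Ok w M s) :
    Represents M (p.run inp s) (p.toInstr.exec inp c) ∧ (p.toInstr.exec inp c).pc = c.pc + 1 ∧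
      (p.toInstr.exec inp c).out = c.out := by
  obtain ⟨h1, h2, h3⟩ := hs
  have hset : ∀ (d : Fin r) (v : BitVec w) (k : ℕ), v.toNat = k → ∀ d',
      (Function.update c.reg d v d').toNat = (s.set d k).reg d' := by
    intro d v k hv d'
    rw [NatState.reg_set, Function.update_apply]
    split_ifs
    · exact hv
    · exact h1 d'
  cases p with
  | const d k =>
    exact ⟨⟨hset _ _ _ (by rw [BitVec.toNat_ofNat, Nat.mod_eq_of_lt hp]), h2, h3⟩, rfl, rfl⟩
  | op o d a b =>
    refine ⟨⟨hset _ _ _ ?_, h2, h3⟩, rfl, rfl⟩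
    rw [Op.toNat_eval, h1, h1]
    rw [h1, h1]; exact hp
  | input d a =>
    exact ⟨⟨hset _ _ _ (by rw [inputAt, h1]), h2, h3⟩, rfl, rfl⟩
  | load d a =>
    refine ⟨⟨hset _ _ _ (by rw [h2, h1]), h2, ?_⟩, rfl, rfl⟩
    have : (c.reg a).toNat < M := by rw [h1]; exact hp
    exact max_le h3 this
  | store a v =>
    refine ⟨⟨h1, fun a' => ?_, ?_⟩, rfl, rfl⟩
    · change (Function.update c.mem (c.reg a) (c.reg v) a').toNat =
        (s.write (s.reg a) (s.reg v)).mem a'.toNat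
      rw [NatState.mem_write, Function.update_apply]
      by_cases h : a' = c.reg a
      · rw [if_pos h, h, if_pos (h1 a), h1]
      · rw [if_neg h, if_neg, h2]
        intro h'
        exact h (BitVec.eq_of_toNat_eq (by rw [h', h1]))
    · have : (c.reg a).toNat < M := by rw [h1]; exact hp
      exact max_le h3 this

theorem Program.step_eq_exec {P : Program} {inp : List (BitVec w)} {cfg : Config P.numRegs w}
    {i : Instr P.numRegs} (h : P.code[cfg.pc]? = some i) : P.step inp cfg = i.exec inp cfg := by
  simp only [Program.step, h]

/-- Correctness of the compilation, with the exact number of steps. -/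
theorem Exec.iterate_step {P : Program} {inp : List (BitVec w)} {M : ℕ} {c : Cmd P.numRegs}
    {s s' : NatState P.numRegs} {t : ℕ} (h : Exec inp M c s t s') :
    ∀ {off : ℕ} {cfg : Config P.numRegs w}, CodeAt P.code off (c.compile off) → cfg.pc = off →
      Represents M s cfg → Represents M s' ((P.step inp)^[t] cfg) ∧
        ((P.step inp)^[t] cfg).pc = off + c.size ∧ ((P.step inp)^[t] cfg).out = cfg.out := by
  have hstep : ∀ {cfg : Config P.numRegs w} {i : Instr P.numRegs}, P.code[cfg.pc]? = some i →
      P.step inp cfg = i.exec inp cfg := Program.step_eq_exec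
  -- a conditional jump that is not taken, followed by a jump
  have hskip : ∀ {cfg : Config P.numRegs w} {off l : ℕ} {i : Instr P.numRegs},
      P.code[off]? = some i → P.code[off + 1]? = some (.jump l) → cfg.pc = off →
      i.exec inp cfg = { cfg with pc := cfg.pc + 1 } →
      (P.step inp)^[2] cfg = { cfg with pc := l } := by
    intro cfg off l i h1 h2 hpc hi
    rw [Function.iterate_succ_apply, Function.iterate_one, hstep (cfg := cfg) (by rw [hpc]; exact h1), hi,
      hstep (i := .jump l) (by rw [← h2, ← hpc])]
    rfl
  induction h with
  | nil =>
    intro off cfg _ hpc hs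
    exact ⟨hs, hpc, rfl⟩
  | @cons p l s t s' hp _ ih =>
    intro off cfg hcode hpc hs
    rw [Cmd.compile, List.map_cons, codeAt_cons] at hcode
    obtain ⟨r1, r2, r3⟩ := Prim.represents_exec (inp := inp) hs hp
    rw [Function.iterate_succ_apply, hstep (by rw [hpc]; exact hcode.1)]
    obtain ⟨i1, i2, i3⟩ := ih (off := off + 1) hcode.2 (by rw [r2, hpc]) r1
    exact ⟨i1, by rw [i2]; simp only [Cmd.size, List.length_cons]; omega, by rw [i3, r3]⟩
  | @seq c₁ c₂ s t₁ s₁ t₂ s₂ _ _ ih₁ ih₂ =>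
    intro off cfg hcode hpc hs
    rw [Cmd.compile, codeAt_append, Cmd.length_compile] at hcode
    obtain ⟨i1, i2, i3⟩ := ih₁ hcode.1 hpc hs
    obtain ⟨j1, j2, j3⟩ := ih₂ hcode.2 i2 i1
    rw [Nat.add_comm, Function.iterate_add_apply]
    exact ⟨j1, by rw [j2, Cmd.size]; omega, by rw [j3, i3]⟩
  | @ifEq_true a b c s t s' hab _ ih =>
    intro off cfg hcode hpc hs
    rw [Cmd.compile, codeAt_append, codeAt_cons, codeAt_cons] at hcode
    obtain ⟨⟨h1, h2, -⟩, h3⟩ := hcode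
    have he : cfg.reg a = cfg.reg b := BitVec.eq_of_toNat_eq (by rw [hs.reg, hs.reg, hab])
    rw [Nat.add_comm, Function.iterate_add_apply, Function.iterate_one,
      hstep (by rw [hpc]; exact h1)]
    obtain ⟨i1, i2, i3⟩ := ih (off := off + 2) (cfg := (Instr.jumpEq a b (off + 2)).exec inp cfg)
      h3 (if_pos he) ⟨hs.reg, hs.mem, hs.used⟩
    exact ⟨i1, by rw [i2, Cmd.size]; omega, i3⟩
  | @ifEq_false a b c s hab =>
    intro off cfg hcode hpc hs
    rw [Cmd.compile, codeAt_append, codeAt_cons, codeAt_cons] at hcode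
    obtain ⟨⟨h1, h2, -⟩, h3⟩ := hcode
    have he : ¬ cfg.reg a = cfg.reg b := fun h => hab (by rw [← hs.reg, ← hs.reg, h])
    rw [hskip h1 h2 hpc (by simp only [Instr.exec, if_neg he])]
    exact ⟨⟨hs.reg, hs.mem, hs.used⟩, rfl, rfl⟩
  | @ifLt_true a b c s t s' hab _ ih =>
    intro off cfg hcode hpc hs
    rw [Cmd.compile, codeAt_append, codeAt_cons, codeAt_cons] at hcode
    obtain ⟨⟨h1, h2, -⟩, h3⟩ := hcode
    have he : (cfg.reg a).toNat < (cfg.reg b).toNat := by rw [hs.reg, hs.reg]; exact hab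
    rw [Nat.add_comm, Function.iterate_add_apply, Function.iterate_one,
      hstep (by rw [hpc]; exact h1)]
    obtain ⟨i1, i2, i3⟩ := ih (off := off + 2) (cfg := (Instr.jumpLt a b (off + 2)).exec inp cfg)
      h3 (if_pos he) ⟨hs.reg, hs.mem, hs.used⟩
    exact ⟨i1, by rw [i2, Cmd.size]; omega, i3⟩
  | @ifLt_false a b c s hab =>
    intro off cfg hcode hpc hs
    rw [Cmd.compile, codeAt_append, codeAt_cons, codeAt_cons] at hcode
    obtain ⟨⟨h1, h2, -⟩, h3⟩ := hcode
    have he : ¬ (cfg.reg a).toNat < (cfg.reg b).toNat := by rw [hs.reg, hs.reg]; exact hab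
    rw [hskip h1 h2 hpc (by simp only [Instr.exec, if_neg he])]
    exact ⟨⟨hs.reg, hs.mem, hs.used⟩, rfl, rfl⟩
  | @while_true a b c s t₁ s₁ t₂ s₂ hab _ _ ih₁ ih₂ =>
    intro off cfg hcode hpc hs
    have hcode' := hcode
    rw [Cmd.compile, codeAt_append, codeAt_append, codeAt_cons, codeAt_cons, codeAt_cons,
      Cmd.length_compile] at hcode
    obtain ⟨⟨h1, h2, -⟩, h3, h4, -⟩ := hcode
    have he : (cfg.reg a).toNat < (cfg.reg b).toNat := by rw [hs.reg, hs.reg]; exact hab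
    obtain ⟨i1, i2, i3⟩ := ih₁ (off := off + 2) (cfg := (Instr.jumpLt a b (off + 2)).exec inp cfg)
      h3 (if_pos he) ⟨hs.reg, hs.mem, hs.used⟩
    rw [Nat.add_comm 1, Function.iterate_add_apply _ _ 1, Function.iterate_one,
      hstep (by rw [hpc]; exact h1), Nat.add_comm t₁, Function.iterate_add_apply _ _ t₁,
      Nat.add_comm 1, Function.iterate_add_apply _ _ 1, Function.iterate_one]
    set cfg₁ := (P.step inp)^[t₁] ((Instr.jumpLt a b (off + 2)).exec inp cfg)
    rw [hstep (cfg := cfg₁) (i := .jump off) (by rw [i2]; exact h4)]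
    obtain ⟨j1, j2, j3⟩ := ih₂ (cfg := (Instr.jump off).exec inp cfg₁) hcode' rfl
      ⟨i1.reg, i1.mem, i1.used⟩
    exact ⟨j1, j2, by rw [j3]; exact i3⟩
  | @while_false a b c s hab =>
    intro off cfg hcode hpc hs
    rw [Cmd.compile, codeAt_append, codeAt_cons, codeAt_cons] at hcode
    obtain ⟨⟨h1, h2, -⟩, h3⟩ := hcode
    have he : ¬ (cfg.reg a).toNat < (cfg.reg b).toNat := by rw [hs.reg, hs.reg]; exact hab
    rw [hskip h1 h2 hpc (by simp only [Instr.exec, if_neg he])]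
    exact ⟨⟨hs.reg, hs.mem, hs.used⟩, rfl, rfl⟩

/-! ### Total correctness with time bounds -/

/-- From `s`, the program `c` terminates within `T` steps in a state that satisfies `Q`. -/
def Ensures (inp : List (BitVec w)) (M : ℕ) (c : Cmd r) (T : ℕ) (s : NatState r)
    (Q : NatState r → Prop) : Prop :=
  ∃ t ≤ T, ∃ s', Exec inp M c s t s' ∧ Q s'

section Ensures

variable {inp : List (BitVec w)} {M : ℕ} {s : NatState r} {Q : NatState r → Prop}

/-- The combined effect of a list of instructions. -/
def runPrims (inp : List (BitVec w)) : List (Prim r) → NatState r → NatState r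
  | [], s => s
  | p :: l, s => runPrims inp l (p.run inp s)

/-- All instructions of the list are admissible when the list is executed. -/
def OkPrims (inp : List (BitVec w)) (M : ℕ) : List (Prim r) → NatState r → Prop
  | [], _ => True
  | p :: l, s => p.Ok w M s ∧ OkPrims inp M l (p.run inp s)

theorem ensures_block {l : List (Prim r)} {T : ℕ} (hT : l.length ≤ T) (hok : OkPrims inp M l s)
    (hQ : Q (runPrims inp l s)) : Ensures inp M (.block l) T s Q := by
  refine ⟨l.length, hT, runPrims inp l s, ?_, hQ⟩
  clear hT hQ
  induction l generalizing s with
  | nil => exact .nil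
  | cons p l ih => exact .cons hok.1 (ih hok.2)

/-- The postcondition may use that the registers that are not written keep their values. -/
theorem Ensures.imp {c : Cmd r} {T T' : ℕ} {Q' : NatState r → Prop} (h : Ensures inp M c T s Q)
    (hT : T ≤ T')
    (hQ : ∀ s', (∀ v, c.writes v = false → s'.reg v = s.reg v) → Q s' → Q' s') :
    Ensures inp M c T' s Q' := by
  obtain ⟨t, ht, s', hs', hq⟩ := h
  exact ⟨t, ht.trans hT, s', hs', hQ s' (fun v hv => hs'.reg_eq hv) hq⟩

theorem Ensures.seq {c₁ c₂ : Cmd r} {T T₁ T₂ : ℕ} {Q₁ : NatState r → Prop}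
    (h₁ : Ensures inp M c₁ T₁ s Q₁) (hT : T₁ + T₂ ≤ T)
    (h₂ : ∀ s', (∀ v, c₁.writes v = false → s'.reg v = s.reg v) → Q₁ s' →
      Ensures inp M c₂ T₂ s' Q) : Ensures inp M (.seq c₁ c₂) T s Q := by
  obtain ⟨t, ht, s', hs', hq⟩ := h₁
  obtain ⟨t', ht', s'', hs'', hq'⟩ := h₂ s' (fun v hv => hs'.reg_eq hv) hq
  exact ⟨t + t', by omega, s'', hs'.seq hs'', hq'⟩

theorem ensures_ifEq {a b : Fin r} {c : Cmd r} {T T' : ℕ} (hT : T + 2 ≤ T')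
    (h₁ : s.reg a = s.reg b → Ensures inp M c T s Q) (h₂ : s.reg a ≠ s.reg b → Q s) :
    Ensures inp M (.ifEq a b c) T' s Q := by
  by_cases h : s.reg a = s.reg b
  · obtain ⟨t, ht, s', hs', hq⟩ := h₁ h
    exact ⟨1 + t, by omega, s', .ifEq_true h hs', hq⟩
  · exact ⟨2, by omega, s, .ifEq_false h, h₂ h⟩

theorem ensures_ifLt {a b : Fin r} {c : Cmd r} {T T' : ℕ} (hT : T + 2 ≤ T')
    (h₁ : s.reg a < s.reg b → Ensures inp M c T s Q) (h₂ : ¬ s.reg a < s.reg b → Q s) :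
    Ensures inp M (.ifLt a b c) T' s Q := by
  by_cases h : s.reg a < s.reg b
  · obtain ⟨t, ht, s', hs', hq⟩ := h₁ h
    exact ⟨1 + t, by omega, s', .ifLt_true h hs', hq⟩
  · exact ⟨2, by omega, s, .ifLt_false h, h₂ h⟩

/-- The loop that runs `c` while `i < n` and increments `i` after each round; the register `one` is
meant to hold `1`. -/
def Cmd.forLt (i n one : Fin r) (c : Cmd r) : Cmd r :=
  .whileLt i n (.seq c (.block [.op .add i i one]))

theorem ensures_forLt {i n one : Fin r} {c : Cmd r} {N T T' : ℕ} (I : ℕ → NatState r → Prop)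
    (hN : N < 2 ^ w) (hi : c.writes i = false) (hnw : c.writes n = false)
    (hone : c.writes one = false) (hin : n ≠ i) (hio : one ≠ i)
    (hsn : s.reg n = N) (hs1 : s.reg one = 1) (hle : s.reg i ≤ N)
    (hT : (N - s.reg i) * (T + 3) + 2 ≤ T') (h0 : I (s.reg i) s)
    (hbody : ∀ k < N, ∀ s', (∀ v, (Cmd.forLt i n one c).writes v = false → s'.reg v = s.reg v) →
      s'.reg i = k → I k s' →
      Ensures inp M c T s' (fun s'' => I (k + 1) (s''.set i (k + 1))))
    (hQ : ∀ s', (∀ v, (Cmd.forLt i n one c).writes v = false → s'.reg v = s.reg v) →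
      s'.reg i = N → I N s' → Q s') :
    Ensures inp M (Cmd.forLt i n one c) T' s Q := by
  have key : ∀ m k, k + m = N → ∀ s', (∀ v, (Cmd.forLt i n one c).writes v = false →
      s'.reg v = s.reg v) → s'.reg i = k → I k s' →
      Ensures inp M (Cmd.forLt i n one c) (m * (T + 3) + 2) s' Q := by
    have hwr : ∀ v, v ≠ i → c.writes v = false → (Cmd.forLt i n one c).writes v = false := by
      intro v hv hc
      simp [Cmd.forLt, Cmd.writes, Prim.writes, hc, hv]
    intro m
    induction m with
    | zero =>
      intro k hk s' hf hki hI
      obtain rfl : k = N := by omega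
      refine ⟨2, by omega, s', .while_false ?_, hQ s' hf hki hI⟩
      rw [hki, hf n (hwr n hin hnw), hsn]
      omega
    | succ m ih =>
      intro k hk s' hf hki hI
      obtain ⟨t, ht, s'', hs'', hq⟩ := hbody k (by omega) s' hf hki hI
      have e1 : s''.reg one = 1 := by rw [hs''.reg_eq hone, hf one (hwr one hio hone), hs1]
      have e2 : s''.reg i = k := by rw [hs''.reg_eq hi, hki]
      have hrun : (Prim.op .add i i one).run inp s'' = s''.set i (k + 1) := by
        simp [Prim.run, Op.natEval, e1, e2]
      have hinc : Exec inp M (.block [.op .add i i one]) s'' 1 (s''.set i (k + 1)) := by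
        refine .cons (t := 0) ?_ ?_
        · change s''.reg i + s''.reg one < 2 ^ w
          omega
        · rw [hrun]; exact .nil
      obtain ⟨t', ht', s₃, hs₃, hq₃⟩ := ih (k + 1) (by omega) (s''.set i (k + 1))
        (fun v hv => by
          have hv' := hv
          simp only [Cmd.forLt, Cmd.writes, List.any_cons, List.any_nil, Prim.writes,
            Bool.or_eq_false_iff, beq_eq_false_iff_ne] at hv
          rw [NatState.reg_set, if_neg hv.2.1, hs''.reg_eq hv.1, hf v hv'])
        (by rw [NatState.reg_set, if_pos rfl]) hq
      refine ⟨1 + ((t + 1) + (1 + t')), ?_, s₃, .while_true ?_ (hs''.seq hinc) hs₃, hq₃⟩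
      · rw [Nat.succ_mul]; omega
      · rw [hki, hf n (hwr n hin hnw), hsn]; omega
  obtain ⟨t, ht, h⟩ := key (N - s.reg i) (s.reg i) (by omega) s (fun _ _ => rfl) rfl h0
  exact ⟨t, ht.trans hT, h⟩

end Ensures

end WordRAM

namespace WordRAM

variable {w : ℕ} {inp : List (BitVec w)} {M : ℕ}

/-! ### Programs for one column -/

theorem ensures_block_seq {r : ℕ} {l : List (Prim r)} {c : Cmd r} {T T' : ℕ} {s : NatState r}
    {Q : NatState r → Prop} (hT : l.length + T ≤ T') (hok : OkPrims inp M l s)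
    (h : Ensures inp M c T (runPrims inp l s) Q) : Ensures inp M (.seq (.block l) c) T' s Q :=
  (ensures_block (Q := fun s' => s' = runPrims inp l s) le_rfl hok rfl).seq hT
    fun _ _ hs' => hs' ▸ h

theorem reg_runPrims {r : ℕ} {l : List (Prim r)} {s : NatState r} {v : Fin r}
    (hv : (Cmd.block l).writes v = false) : (runPrims inp l s).reg v = s.reg v := by
  induction l generalizing s with
  | nil => rfl
  | cons p l ih =>
    simp only [Cmd.writes, List.any_cons, Bool.or_eq_false_iff] at hv
    rw [runPrims, ih hv.2, Prim.reg_run_of_not_writes hv.1]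

/-- Copying a register. -/
def Prim.mov {r : ℕ} (d a : Fin r) : Prim r := .op .or d a a

/-- `reg[d] := max reg[d] reg[a]` -/
def Cmd.maxWith {r : ℕ} (d a : Fin r) : Cmd r := .ifLt d a (.block [.mov d a])

attribute [simp] OkPrims runPrims Prim.Ok Prim.run Op.NoOverflow Op.natEval NatState.reg_set
  NatState.mem_set NatState.reg_write NatState.mem_write Prim.mov

theorem ensures_maxWith {r : ℕ} {d a : Fin r} {T : ℕ} {s : NatState r} {Q : NatState r → Prop}
    (hT : 3 ≤ T) (h : Q (s.set d (max (s.reg d) (s.reg a)))) :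
    Ensures inp M (Cmd.maxWith d a) T s Q := by
  refine ensures_ifLt (T := 1) hT (fun hlt => ensures_block le_rfl (by simp) ?_) fun hlt => ?_
  · rw [max_eq_right hlt.le] at h
    simpa using h
  · rw [max_eq_left (not_lt.1 hlt)] at h
    convert h
    cases s
    simp [NatState.set]

namespace Reg

/-! The registers. The first twelve are set once and for all (see `Consts`). Register `task` holds
the number of the current task, `e` the level that is decoded, `src`, `sseg`, `tgt`, `tseg`, `strip`
describe the task (see `HoldsTask`), `row` is the first row of its strip, `j` and `r` are the column
and the row in the strip, `y` is the symbol of the column, `cur` the cell computed last, `diag` its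
predecessor in the column before, and `i` is a loop counter. -/

@[simp] abbrev zero : Fin 32 := 0
@[simp] abbrev one : Fin 32 := 1
@[simp] abbrev n : Fin 32 := 2
@[simp] abbrev q : Fin 32 := 3
@[simp] abbrev k : Fin 32 := 4
@[simp] abbrev b : Fin 32 := 5
@[simp] abbrev cb : Fin 32 := 6
@[simp] abbrev fin : Fin 32 := 7
@[simp] abbrev tot : Fin 32 := 8
@[simp] abbrev q1 : Fin 32 := 9
@[simp] abbrev b1 : Fin 32 := 10
@[simp] abbrev n1 : Fin 32 := 11
@[simp] abbrev task : Fin 32 := 12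
@[simp] abbrev e : Fin 32 := 13
@[simp] abbrev src : Fin 32 := 14
@[simp] abbrev sseg : Fin 32 := 15
@[simp] abbrev tgt : Fin 32 := 16
@[simp] abbrev tseg : Fin 32 := 17
@[simp] abbrev strip : Fin 32 := 18
@[simp] abbrev j : Fin 32 := 19
@[simp] abbrev r : Fin 32 := 20
@[simp] abbrev diag : Fin 32 := 21
@[simp] abbrev cur : Fin 32 := 22
@[simp] abbrev t1 : Fin 32 := 23
@[simp] abbrev t2 : Fin 32 := 24
@[simp] abbrev t3 : Fin 32 := 25
@[simp] abbrev y : Fin 32 := 26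
@[simp] abbrev row : Fin 32 := 27
@[simp] abbrev i : Fin 32 := 28

end Reg

/-- One cell of the dynamic program. The column is overwritten in place: `cur` holds the cell above
(in the same column), `diag` the one above in the column before. -/
def cellCmd : Cmd 32 :=
  .seq (.block [.op .add Reg.t1 Reg.cb Reg.r, .op .add Reg.t1 Reg.t1 Reg.one,
    .load Reg.t2 Reg.t1, .op .add Reg.t3 Reg.row Reg.r]) <|
  .seq (.maxWith Reg.cur Reg.t2) <|
  .seq (.ifLt Reg.t3 Reg.n
    (.seq (.block [.op .add Reg.t3 Reg.t3 Reg.one, .input Reg.t3 Reg.t3]) <|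
      .ifEq Reg.t3 Reg.y
        (.seq (.block [.op .add Reg.diag Reg.diag Reg.one]) <|
          .maxWith Reg.cur Reg.diag))) <|
  .block [.store Reg.t1 Reg.cur, .mov Reg.diag Reg.t2]

theorem ensures_cellCmd {s : NatState 32} {n c ρ L y f₀ f₁ g : ℕ} {m : Bool}
    (hone : s.reg Reg.one = 1) (hn : s.reg Reg.n = n) (hc : s.reg Reg.cb = c)
    (hr : s.reg Reg.r = ρ) (hrow : s.reg Reg.row = L) (hy : s.reg Reg.y = y)
    (hdiag : s.reg Reg.diag = f₀) (hcur : s.reg Reg.cur = g) (hmem : s.mem (c + ρ + 1) = f₁)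
    (hM : c + ρ + 1 < M) (hMw : M < 2 ^ w) (hL : L + ρ + 1 < 2 ^ w) (hf : f₀ + 1 < 2 ^ w)
    (hm : m = true ↔ L + ρ < n ∧ inputAt inp (L + ρ + 1) = y) :
    Ensures inp M cellCmd 24 s fun s' =>
      s'.reg Reg.cur = max (max f₁ g) (if m then f₀ + 1 else 0) ∧ s'.reg Reg.diag = f₁ ∧
      ∀ a, s'.mem a = if a = c + ρ + 1 then max (max f₁ g) (if m then f₀ + 1 else 0)
        else s.mem a := by
  refine ensures_block_seq (T := 20) le_rfl ?_ ?_
  · simp [*]; omega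
  refine Ensures.seq (T₁ := 3) (T₂ := 17) (ensures_maxWith le_rfl (Q := fun s' => s' = _) rfl)
    le_rfl fun s₁ _ hs₁ => ?_
  simp [*] at hs₁
  refine Ensures.seq (T₁ := 12) (T₂ := 2) (Q₁ := fun s₂ =>
      s₂.reg Reg.cur = max (max f₁ g) (if m then f₀ + 1 else 0) ∧ s₂.mem = s₁.mem) ?_ (by omega) ?_
  · refine ensures_ifLt (T := 10) le_rfl (fun h => ?_) fun h => ?_
    · refine ensures_block_seq (T := 8) le_rfl (by simp [*]) ?_
      refine ensures_ifEq (T := 4) (by omega) (fun h' => ?_) fun h' => ?_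
      · refine ensures_block_seq (T := 3) le_rfl (by simp [*]) ?_
        refine ensures_maxWith le_rfl ?_
        simp [*] at h h' ⊢
        rw [if_pos ⟨h, h'⟩]
        omega
      · simp [*] at h h' ⊢
        rw [if_neg (by tauto)]
        omega
    · simp [*] at h ⊢
      rw [if_neg (by omega)]
      omega
  · intro s₂ hf₂ hs₂
    have e1 := hf₂ Reg.t1 rfl
    have e2 := hf₂ Reg.t2 rfl
    simp [hs₁] at e1 e2
    refine ensures_block le_rfl (by simp [e1, hM]) ?_
    simp [*]

/-- `mem[reg[base] + i] := 0` for all `i < reg[len]` -/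
def clearCmd (base len : Fin 32) : Cmd 32 :=
  .seq (.block [.mov Reg.i Reg.zero]) <|
  .forLt Reg.i len Reg.one (.block [.op .add Reg.t1 base Reg.i, .store Reg.t1 Reg.zero])

theorem ensures_clearCmd {base len : Fin 32} {s : NatState 32} {c l T : ℕ}
    (hzero : s.reg Reg.zero = 0) (hone : s.reg Reg.one = 1) (hc : s.reg base = c)
    (hl : s.reg len = l) (hb : base ≠ Reg.i ∧ base ≠ Reg.t1) (hl' : len ≠ Reg.i ∧ len ≠ Reg.t1)
    (hM : c + l ≤ M) (hMw : M < 2 ^ w) (hT : l * 5 + 3 ≤ T) :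
    Ensures inp M (clearCmd base len) T s fun s' =>
      ∀ a, s'.mem a = if c ≤ a ∧ a < c + l then 0 else s.mem a := by
  refine ensures_block_seq (T := l * 5 + 2) (by simp; omega) (by simp) ?_
  obtain ⟨hb1, hb2⟩ := hb
  obtain ⟨hl1, hl2⟩ := hl'
  simp only [Reg.i, Reg.t1] at hb1 hb2 hl1 hl2
  have hw : ∀ v : Fin 32, v ≠ Reg.i → v ≠ Reg.t1 → (Cmd.forLt Reg.i len Reg.one
      (.block [.op .add Reg.t1 base Reg.i, .store Reg.t1 Reg.zero])).writes v = false := by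
    intro v h1 h2
    simp only [Reg.i, Reg.t1] at h1 h2
    simp [Cmd.forLt, Cmd.writes, Prim.writes, h1, h2]
  refine ensures_forLt (N := l) (T := 2)
    (fun k s' => ∀ a, s'.mem a = if c ≤ a ∧ a < c + k then 0 else s.mem a) (by omega) rfl ?_ rfl hl1
    (by simp) (by simp [hl1, hl]) (by simp [hone]) (by simp [hzero]) (by simp [hzero]) ?_ ?_ ?_
  · simp [Cmd.writes, Prim.writes, hl2]
  · intro a
    simp [hzero]
  · intro k hk s' hf hi hI
    have e1 := hf base (hw _ hb1 hb2)
    have e2 := hf Reg.zero (hw _ (by simp) (by simp))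
    simp [hb1, hc, hzero] at e1 e2 hi
    refine ensures_block le_rfl (by simp [e1, hi]; omega) ?_
    intro a
    simp [e1, e2, hi, hI]
    split_ifs <;> first | rfl | omega
  · intro s' _ _ hI
    exact hI

/-- The registers that are set once and for all. -/
structure Consts (n q b : ℕ) (s : NatState 32) : Prop where
  reg_zero : s.reg Reg.zero = 0
  reg_one : s.reg Reg.one = 1
  reg_n : s.reg Reg.n = n
  reg_q : s.reg Reg.q = q
  reg_k : s.reg Reg.k = 2 ^ q
  reg_b : s.reg Reg.b = b
  reg_cb : s.reg Reg.cb = (q + 2) * b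
  reg_fin : s.reg Reg.fin = n / b
  reg_tot : s.reg Reg.tot = 2 ^ (q * (q + 1))
  reg_q1 : s.reg Reg.q1 = q + 1
  reg_b1 : s.reg Reg.b1 = b + 1
  reg_n1 : s.reg Reg.n1 = n + 1

theorem Consts.congr {n q b : ℕ} {s s' : NatState 32} (h : Consts n q b s)
    (hs : ∀ v < 12, s'.reg v = s.reg v) : Consts n q b s' := by
  obtain ⟨h0, h1, h2, h3, h4, h5, h6, h7, h8, h9, h10, h11⟩ := h
  constructor <;> rw [hs _ (by decide)] <;> assumption

/-- The parameters are admissible: they are small compared with the word size, and `M` is the size of the memory: there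
are `q + 2` buffers of `b` words and one column of `b + 1` words. The strips and the segments cover
the table. -/
structure Sizes (w M n q b : ℕ) : Prop where
  hM : M = (q + 2) * b + (b + 1)
  hMw : M < 2 ^ w
  hn : 2 * n + 2 < 2 ^ w
  hnn : n * n < 2 ^ w
  htot : 2 ^ (q * (q + 1)) < 2 ^ w
  hrows : 2 ^ q * b + 1 < 2 ^ w
  hqq : (q + 1) * (q + 1) < 2 ^ w
  hb : 0 < b
  hnb : n < 2 ^ q * b

/-- The relation `mt` compares the symbols of the two strings in the input memory: symbol `r` of the
first string is in cell `r + 1`, and symbol `j` of the second one is in cell `n + (j + 1)`. -/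
def MatchesInput (inp : List (BitVec w)) (n : ℕ) (mt : ℕ → ℕ → Bool) : Prop :=
  ∀ r j, mt r j = true ↔ r < n ∧ j < n ∧ inputAt inp (r + 1) = inputAt inp (n + (j + 1))

/-- One column of the dynamic program below its first cell. -/
def columnCmd : Cmd 32 :=
  .seq (.block [.store Reg.cb Reg.cur, .mov Reg.r Reg.zero]) <|
  .forLt Reg.r Reg.b Reg.one cellCmd

theorem ensures_columnCmd {s : NatState 32} {n q b L j : ℕ} {mt : ℕ → ℕ → Bool} {top : ℕ → ℕ}
    (hs : Consts n q b s) (hz : Sizes w M n q b) (hmt : MatchesInput inp n mt) (hj : j < n)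
    (hL : L + b ≤ 2 ^ q * b) (hrow : s.reg Reg.row = L)
    (hy : s.reg Reg.y = inputAt inp (n + (j + 1)))
    (hE : ∀ r j, stripTable (fun r j => mt (L + r) j) top r j ≤ j)
    (hdiag : s.reg Reg.diag = stripTable (fun r j => mt (L + r) j) top 0 j)
    (hcur : s.reg Reg.cur = stripTable (fun r j => mt (L + r) j) top 0 (j + 1))
    (hcol : ∀ r ≤ b, s.mem ((q + 2) * b + r) = stripTable (fun r j => mt (L + r) j) top r j) :
    Ensures inp M columnCmd (b * 27 + 4) s fun s' =>
      s'.reg Reg.cur = stripTable (fun r j => mt (L + r) j) top b (j + 1) ∧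
      (∀ r ≤ b, s'.mem ((q + 2) * b + r) = stripTable (fun r j => mt (L + r) j) top r (j + 1)) ∧
      ∀ a < (q + 2) * b, s'.mem a = s.mem a := by
  set E := stripTable (fun r j => mt (L + r) j) top with hEdef
  set c := (q + 2) * b with hcdef
  obtain ⟨hM, hMw, hnw, -, -, hrows, -, hb, -⟩ := hz
  have hs' := hs
  obtain ⟨h0, h1, h2, h3, h4, h5, h6, h7, h8, h9, h10, h11⟩ := hs
  rw [← hcdef] at h6 hM
  refine ensures_block_seq (T := b * 27 + 2) (by simp; omega) (by simp [h6]; omega) ?_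
  refine ensures_forLt (N := b) (T := 24) (fun k s' =>
    s'.reg Reg.cur = E k (j + 1) ∧ s'.reg Reg.diag = E k j ∧
    (∀ r ≤ b, s'.mem (c + r) = if r ≤ k then E r (j + 1) else E r j) ∧
    ∀ a < c, s'.mem a = s.mem a) (by omega) rfl rfl rfl
    (by simp) (by simp) (by simp [h5]) (by simp [h1]) (by simp [h0]) (by simp [h0]) ?_ ?_ ?_
  · simp [h0, hcur, hdiag, h6]
    refine ⟨fun r hr => ?_, fun a ha => by omega⟩
    rw [hcol r hr]
    split_ifs with h
    · rw [h]
    · rfl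
  · rintro k hk s' hf hi ⟨i1, i2, i3, i4⟩
    have hc' : Consts n q b s' := hs'.congr fun v hv => by
      rw [hf v (by revert v; decide), reg_runPrims (by revert v; decide)]
    obtain ⟨-, k1, k2, -, -, -, k6, -⟩ := hc'
    have e1 := hf Reg.row rfl
    have e2 := hf Reg.y rfl
    simp [hrow, hy] at e1 e2
    refine (ensures_cellCmd (m := mt (L + k) j) k1 k2 k6 hi e1 e2 i2 i1
      (f₁ := E (k + 1) j) ?_ ?_ hMw ?_ ?_ ?_).imp le_rfl ?_
    · rw [← hcdef, Nat.add_assoc, i3 (k + 1) (by omega), if_neg (by omega)]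
    · omega
    · omega
    · have := hE k j
      omega
    · rw [hmt]
      have : j < n := hj
      tauto
    · rintro s'' - ⟨j1, j2, j3⟩
      rw [← hcdef] at j3
      have hrec : E (k + 1) (j + 1) = _ := stripTable_succ_succ _ _ k j
      simp only [NatState.reg_set, NatState.mem_set]
      refine ⟨?_, ?_, fun r hr => ?_, fun a ha => ?_⟩
      · rw [if_neg (by simp), j1, hrec]
      · rw [if_neg (by simp), j2]
      · rw [j3, ← hrec]
        by_cases h : r = k + 1
        · rw [if_pos (by omega), if_pos (by omega), h]
        · rw [if_neg (by omega), i3 r hr]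
          split_ifs <;> first | rfl | omega
      · rw [j3, if_neg (by omega), i4 a ha]
  · rintro s' - - ⟨i1, -, i3, i4⟩
    exact ⟨i1, fun r hr => by rw [i3 r hr, if_pos hr], i4⟩

/-! ### The program for one strip -/

/-- Buffer `e` of the state `s` holds `B e`, for the `q + 2` buffers. -/
def HoldsBufs (q b : ℕ) (B : ℕ → ℕ → ℕ) (s : NatState 32) : Prop :=
  ∀ e ≤ q + 1, ∀ o < b, s.mem (e * b + o) = B e o

theorem bufAddr_lt {q b e o : ℕ} (he : e ≤ q + 1) (ho : o < b) : e * b + o < (q + 2) * b := by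
  have : (e + 1) * b ≤ (q + 2) * b := Nat.mul_le_mul_right _ (by omega)
  rw [Nat.succ_mul] at this
  omega

theorem bufAddr_inj {b e o e' o' : ℕ} (ho : o < b) (ho' : o' < b) :
    e * b + o = e' * b + o' ↔ e = e' ∧ o = o' := by
  constructor
  · intro h
    have hb : 0 < b := by omega
    have h1 : (e * b + o) / b = e := by
      rw [Nat.mul_comm, Nat.mul_add_div hb, Nat.div_eq_of_lt ho, Nat.add_zero]
    have h2 : (e' * b + o') / b = e' := by
      rw [Nat.mul_comm, Nat.mul_add_div hb, Nat.div_eq_of_lt ho', Nat.add_zero]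
    have : e = e' := by rw [← h1, ← h2, h]
    subst this
    omega
  · rintro ⟨rfl, rfl⟩; rfl

/-- The registers that describe the current task. -/
structure HoldsTask (b : ℕ) (d : StripTask) (s : NatState 32) : Prop where
  reg_src : s.reg Reg.src = d.src * b
  reg_sseg : s.reg Reg.sseg = d.sseg
  reg_tgt : s.reg Reg.tgt = d.tgt * b
  reg_tseg : s.reg Reg.tseg = d.tseg
  reg_strip : s.reg Reg.strip = d.strip

theorem HoldsTask.congr {b : ℕ} {d : StripTask} {s s' : NatState 32} (h : HoldsTask b d s)
    (hs : ∀ v, 14 ≤ v → v < 19 → s'.reg v = s.reg v) : HoldsTask b d s' := by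
  obtain ⟨h0, h1, h2, h3, h4⟩ := h
  constructor <;> rw [hs _ (by decide) (by decide)] <;> assumption

/-- One column of the dynamic program, including the input from the source buffer and the output to
the target buffer. -/
def fullColumnCmd : Cmd 32 :=
  .seq (.block [.op .add Reg.t1 Reg.n Reg.j, .input Reg.y Reg.t1, .load Reg.diag Reg.cb,
    .mov Reg.cur Reg.diag, .op .div Reg.t1 Reg.j Reg.b, .op .mod Reg.t2 Reg.j Reg.b,
    .op .add Reg.t3 Reg.src Reg.t2]) <|
  .seq (.ifEq Reg.t1 Reg.sseg (.seq (.block [.load Reg.t3 Reg.t3]) (.maxWith Reg.cur Reg.t3))) <|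
  .seq columnCmd <|
  .seq (.block [.op .div Reg.t1 Reg.j Reg.b, .op .mod Reg.t2 Reg.j Reg.b,
    .op .add Reg.t3 Reg.tgt Reg.t2]) <|
  .ifEq Reg.t1 Reg.tseg (.seq (.block [.load Reg.t1 Reg.t3])
    (.ifLt Reg.t1 Reg.cur (.block [.store Reg.t3 Reg.cur])))

/-- The buffers while the task `d` is executed, before column `j`. -/
def partialTask (mt : ℕ → ℕ → Bool) (b : ℕ) (d : StripTask) (B : ℕ → ℕ → ℕ) (j e o : ℕ) : ℕ :=
  if e = d.tgt ∧ d.tseg * b + o < j then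
    max (B e o) (stripTable (fun r j => mt (d.strip * b + r) j) (bufTop b B d.src d.sseg) b
      (d.tseg * b + o))
  else B e o

theorem partialTask_succ (mt : ℕ → ℕ → Bool) (b : ℕ) (d : StripTask) (B : ℕ → ℕ → ℕ) (j e : ℕ)
    {o : ℕ} (ho : o < b) :
    partialTask mt b d B (j + 1) e o =
      if e = d.tgt ∧ o = j % b ∧ j / b = d.tseg then
        max (partialTask mt b d B j e o)
          (stripTable (fun r j => mt (d.strip * b + r) j) (bufTop b B d.src d.sseg) b j)
      else partialTask mt b d B j e o := by
  have hb : 0 < b := by omega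
  have key : d.tseg * b + o = j ↔ o = j % b ∧ j / b = d.tseg := by
    have h := bufAddr_inj (e := d.tseg) (e' := j / b) ho (Nat.mod_lt j hb)
    rw [Nat.mul_comm (j / b), Nat.div_add_mod] at h
    rw [h]
    tauto
  unfold partialTask
  by_cases h1 : e = d.tgt
  · simp only [h1, true_and, ← key]
    rcases lt_trichotomy (d.tseg * b + o) j with h | h | h
    · rw [if_pos (by omega), if_neg (by omega), if_pos h]
    · rw [if_pos (by omega), if_pos h, if_neg (by omega), h]
    · rw [if_neg (by omega), if_neg (by omega), if_neg (by omega)]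
  · simp only [h1, false_and, if_false]

theorem ensures_fullColumnCmd {s : NatState 32} {n q b j : ℕ} {mt : ℕ → ℕ → Bool}
    {d : StripTask} {B : ℕ → ℕ → ℕ}
    (hs : Consts n q b s) (hz : Sizes w M n q b) (hmt : MatchesInput inp n mt) (hj : j < n)
    (hd : HoldsTask b d s) (hsrc : d.src ≤ q + 1) (htgt : d.tgt ≤ q) (hne : d.src ≠ d.tgt)
    (hstrip : d.strip < 2 ^ q) (hrow : s.reg Reg.row = d.strip * b) (hjr : s.reg Reg.j = j + 1)
    (hE : ∀ r j, stripTable (fun r j => mt (d.strip * b + r) j) (bufTop b B d.src d.sseg) r j ≤ j)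
    (hB : HoldsBufs q b (partialTask mt b d B (j + 1)) s)
    (hcol : ∀ r ≤ b, s.mem ((q + 2) * b + r) =
      stripTable (fun r j => mt (d.strip * b + r) j) (bufTop b B d.src d.sseg) r j) :
    Ensures inp M fullColumnCmd (b * 27 + 26) s fun s' =>
      HoldsBufs q b (partialTask mt b d B (j + 2)) s' ∧
      ∀ r ≤ b, s'.mem ((q + 2) * b + r) =
        stripTable (fun r j => mt (d.strip * b + r) j) (bufTop b B d.src d.sseg) r (j + 1) := by
  set top := bufTop b B d.src d.sseg with htop
  set L := d.strip * b with hLdef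
  set E := stripTable (fun r j => mt (L + r) j) top with hEdef
  have hz' := hz
  obtain ⟨hM, hMw, hnw, -, -, hrows, -, hb, -⟩ := hz
  have hs' := hs
  obtain ⟨h0, h1, h2, h3, h4, h5, h6, h7, h8, h9, h10, h11⟩ := hs
  have hd' := hd
  obtain ⟨d1, d2, d3, d4, d5⟩ := hd
  have hmod : (j + 1) % b < b := Nat.mod_lt _ hb
  have hasrc := bufAddr_lt (b := b) hsrc hmod
  have hatgt := bufAddr_lt (b := b) (e := d.tgt) (q := q) (by omega) hmod
  refine ensures_block_seq (T := b * 27 + 19) (by simp; omega) ?_ ?_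
  · simp [h2, hjr, h6, h5, d1]; omega
  -- the first cell of the column
  have hm0 := hcol 0 (by omega)
  rw [Nat.add_zero] at hm0
  refine Ensures.seq (T₁ := 6) (T₂ := b * 27 + 13) (Q₁ := fun s₁ =>
    s₁.reg Reg.cur = E 0 (j + 1) ∧ s₁.mem = s.mem) ?_ (by omega) ?_
  · have hE0 : E 0 (j + 1) = max (E 0 j) (top (j + 1)) := stripTable_zero_left _ _ _
    refine ensures_ifEq (T := 4) le_rfl (fun h => ?_) fun h => ?_
    · simp [hjr, h5, d2] at h
      refine ensures_block_seq (T := 3) le_rfl ?_ (ensures_maxWith le_rfl ?_)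
      · simp [d1, hjr, h5]; omega
      · simp [d1, hjr, h5, h6, hm0]
        rw [hB _ hsrc _ hmod, partialTask, if_neg (fun h' => hne h'.1), hE0, htop, bufTop, if_pos h]
    · simp [hjr, h5, d2] at h
      simp [h6, hm0]
      rw [hE0, htop, bufTop, if_neg h]
      omega
  rintro s₁ hf₁ ⟨hcur₁, hmem₁⟩
  have hc₁ : Consts n q b s₁ := hs'.congr fun v hv => by
    rw [hf₁ v (by revert v; decide), reg_runPrims (by revert v; decide)]
  have hd₁ : HoldsTask b d s₁ := hd'.congr fun v hv hv' => by
    rw [hf₁ v (by revert v; decide), reg_runPrims (by revert v; decide)]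
  have e1 := hf₁ Reg.row rfl
  have e2 := hf₁ Reg.y rfl
  have e3 := hf₁ Reg.diag rfl
  have e4 := hf₁ Reg.j rfl
  simp [hrow, h2, hjr, h6, hm0] at e1 e2 e3 e4
  have hL : L + b ≤ 2 ^ q * b := by
    rw [hLdef, ← Nat.succ_mul]
    exact Nat.mul_le_mul_right _ hstrip
  -- the other cells of the column
  refine (ensures_columnCmd hc₁ hz' hmt hj hL e1 e2 hE e3 hcur₁ (fun r hr => by
    rw [hmem₁, hcol r hr])).seq (T₂ := 9) (by omega) ?_
  rintro s₂ hf₂ ⟨hcur₂, hcol₂, hmem₂⟩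
  have hc₂ : Consts n q b s₂ := hc₁.congr fun v hv => hf₂ v (by revert v; decide)
  have hd₂ : HoldsTask b d s₂ := hd₁.congr fun v hv hv' => hf₂ v (by revert v; decide)
  obtain ⟨-, -, -, -, -, k5, -⟩ := hc₂
  obtain ⟨-, -, d3', d4', -⟩ := hd₂
  have hj₂ := hf₂ Reg.j rfl
  simp [e4] at hj₂
  have hB₂ : HoldsBufs q b (partialTask mt b d B (j + 1)) s₂ := fun e he o ho => by
    rw [hmem₂ _ (bufAddr_lt he ho), hmem₁, ← hB e he o ho]
  -- the output
  have hdone : (j + 1) / b ≠ d.tseg → HoldsBufs q b (partialTask mt b d B (j + 2)) s₂ := by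
    intro h e he o ho
    rw [partialTask_succ _ _ _ _ _ _ ho, if_neg (fun h' => h h'.2.2), hB₂ e he o ho]
  have htgtmem := hB₂ d.tgt (by omega) _ hmod
  refine ensures_block_seq (T := 6) (by simp) ?_ ?_
  · simp [d3', hj₂, k5]; omega
  refine ensures_ifEq (T := 4) le_rfl (fun h => ?_) fun h => ?_
  swap
  · simp [d4', hj₂, k5] at h
    exact ⟨hdone h, hcol₂⟩
  simp [d4', hj₂, k5] at h
  refine ensures_block_seq (T := 3) le_rfl ?_ ?_
  · simp [d3', hj₂, k5]; omega
  have hsucc : ∀ e o, o < b → partialTask mt b d B (j + 2) e o =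
      if e = d.tgt ∧ o = (j + 1) % b then max (partialTask mt b d B (j + 1) e o) (E b (j + 1))
      else partialTask mt b d B (j + 1) e o := by
    intro e o ho
    rw [partialTask_succ _ _ _ _ _ _ ho]
    simp only [h, and_true]
    rfl
  refine ensures_ifLt (T := 1) le_rfl (fun h' => ensures_block le_rfl ?_ ?_) fun h' => ?_
  · simp [d3', hj₂, k5]; omega
  · simp [d3', hj₂, k5, hcur₂, htgtmem] at h'
    refine ⟨fun e he o ho => ?_, fun r hr => ?_⟩
    · rw [hsucc e o ho]
      simp [d3', hj₂, k5, hcur₂, bufAddr_inj ho hmod]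
      split_ifs with h''
      · rw [h''.1, h''.2, max_eq_right h'.le]
      · exact hB₂ e he o ho
    · simp [d3', hj₂, k5]
      rw [if_neg (by omega), hcol₂ r hr]
  · simp [d3', hj₂, k5, hcur₂, htgtmem] at h'
    refine ⟨fun e he o ho => ?_, fun r hr => ?_⟩
    · rw [hsucc e o ho]
      simp
      split_ifs with h''
      · rw [h''.1, h''.2, max_eq_left h', htgtmem]
      · exact hB₂ e he o ho
    · simp
      exact hcol₂ r hr

/-- The dynamic program in the strip of a task. -/
def stripCmd : Cmd 32 :=
  .seq (.block [.op .mul Reg.row Reg.strip Reg.b]) <|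
  .seq (clearCmd Reg.cb Reg.b1) <|
  .seq (.block [.mov Reg.j Reg.one]) <|
  .forLt Reg.j Reg.n1 Reg.one fullColumnCmd

theorem ensures_stripCmd {s : NatState 32} {n q b : ℕ} {mt : ℕ → ℕ → Bool}
    {d : StripTask} {B : ℕ → ℕ → ℕ}
    (hs : Consts n q b s) (hz : Sizes w M n q b) (hmt : MatchesInput inp n mt)
    (hd : HoldsTask b d s) (hsrc : d.src ≤ q + 1) (htgt : d.tgt ≤ q) (hne : d.src ≠ d.tgt)
    (hstrip : d.strip < 2 ^ q)
    (hE : ∀ r j, stripTable (fun r j => mt (d.strip * b + r) j) (bufTop b B d.src d.sseg) r j ≤ j)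
    (hB : HoldsBufs q b B s) :
    Ensures inp M stripCmd (n * (b * 27 + 29) + b * 5 + 12) s (HoldsBufs q b (runTask mt n b d B)) := by
  have hz' := hz
  obtain ⟨hM, hMw, hnw, -, -, hrows, -, hb, -⟩ := hz
  have hL : (d.strip + 1) * b ≤ 2 ^ q * b := Nat.mul_le_mul_right _ hstrip
  rw [Nat.succ_mul] at hL
  have hs' := hs
  obtain ⟨h0, h1, h2, h3, h4, h5, h6, h7, h8, h9, h10, h11⟩ := hs
  refine ensures_block_seq (T := n * (b * 27 + 29) + b * 5 + 11) (by simp; omega) ?_ ?_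
  · simp [hd.reg_strip, h5]; omega
  refine (ensures_clearCmd (c := (q + 2) * b) (l := b + 1) (T := (b + 1) * 5 + 3)
    (by simp [h0]) (by simp [h1]) (by simp [h6]) (by simp [h10]) (by simp) (by simp) (by omega) hMw
    le_rfl).seq (T₂ := n * (b * 27 + 29) + 3) (by omega) ?_
  intro s₁ hf₁ hm₁
  have hc₁ : Consts n q b s₁ := hs'.congr fun v hv => by
    rw [hf₁ v (by revert v; decide), reg_runPrims (by revert v; decide)]
  have hd₁ : HoldsTask b d s₁ := hd.congr fun v hv hv' => by
    rw [hf₁ v (by revert v; decide), reg_runPrims (by revert v; decide)]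
  have hrow₁ := hf₁ Reg.row rfl
  simp [hd.reg_strip, h5] at hrow₁
  refine ensures_block_seq (T := n * (b * 27 + 29) + 2) (by simp; omega) (by simp) ?_
  refine ensures_forLt (N := n + 1) (T := b * 27 + 26) (fun j s' => 1 ≤ j ∧
    HoldsBufs q b (partialTask mt b d B j) s' ∧ ∀ r ≤ b, s'.mem ((q + 2) * b + r) =
      stripTable (fun r j => mt (d.strip * b + r) j) (bufTop b B d.src d.sseg) r (j - 1))
    (by omega) rfl rfl rfl (by simp) (by simp) (by simp [hc₁.reg_n1]) (by simp [hc₁.reg_one])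
    (by simp [hc₁.reg_one]) (by simp [hc₁.reg_one]) ?_ ?_ ?_
  · simp [hc₁.reg_one]
    refine ⟨fun e he o ho => ?_, fun r hr => ?_⟩
    · have := bufAddr_lt he ho
      simp [hm₁]
      rw [if_neg (by omega), hB e he o ho, partialTask]
      split_ifs with h
      · rw [show d.tseg * b + o = 0 by omega, stripTable_zero_right, max_eq_left (Nat.zero_le _)]
      · rfl
    · rw [hm₁, if_pos (by omega), stripTable_zero_right]
  · rintro k hk s' hf hi ⟨i1, i2, i3⟩
    obtain ⟨j, rfl⟩ : ∃ j, k = j + 1 := ⟨k - 1, by omega⟩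
    have hc' : Consts n q b s' := hc₁.congr fun v hv => by
      rw [hf v (by revert v; decide), reg_runPrims (by revert v; decide)]
    have hd' : HoldsTask b d s' := hd₁.congr fun v hv hv' => by
      rw [hf v (by revert v; decide), reg_runPrims (by revert v; decide)]
    have hrow' := hf Reg.row rfl
    simp [hrow₁] at hrow'
    refine (ensures_fullColumnCmd hc' hz' hmt (by omega) hd' hsrc htgt hne hstrip hrow' hi hE i2
      i3).imp le_rfl ?_
    rintro s'' - ⟨j1, j2⟩
    exact ⟨by omega, j1, j2⟩
  · rintro s' - - ⟨-, i2, -⟩ e he o ho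
    rw [i2 e he o ho, partialTask, runTask]
    simp only [Nat.lt_succ_iff]

/-! ### The program for all tasks -/

/-- Decoding the digit of one level, and clearing the buffer of the level if its guess is new. In
`t2` and `diag` there are the two parts of the digit, in `cur` the address of the buffer, and `y` is
the number of the task with the bits below the guess removed. -/
def levelCmd : Cmd 32 :=
  .seq (.block [.op .sub Reg.t1 Reg.q Reg.e, .op .sub Reg.t1 Reg.t1 Reg.one,
    .op .mul Reg.t1 Reg.t1 Reg.q1, .op .shr Reg.t2 Reg.task Reg.t1, .op .shr Reg.t3 Reg.t2 Reg.one,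
    .op .add Reg.strip Reg.strip Reg.strip, .op .and Reg.t2 Reg.t2 Reg.one,
    .op .mod Reg.diag Reg.t3 Reg.k, .op .mul Reg.cur Reg.e Reg.b, .op .add Reg.t1 Reg.t1 Reg.one,
    .op .shl Reg.y Reg.t3 Reg.t1]) <|
  .seq (.ifEq Reg.t2 Reg.one (.block [.mov Reg.src Reg.cur, .mov Reg.sseg Reg.diag,
    .op .add Reg.strip Reg.strip Reg.one])) <|
  .seq (.ifEq Reg.t2 Reg.zero (.block [.mov Reg.tgt Reg.cur, .mov Reg.tseg Reg.diag])) <|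
  .ifEq Reg.y Reg.task (clearCmd Reg.cur Reg.b)

theorem isFresh_iff {q e T : ℕ} (he : e < q) : IsFresh q e T ↔
    T / 2 ^ digitShift q e / 2 * 2 ^ (digitShift q e + 1) = T := by
  rw [Nat.div_div_eq_div_mul, ← pow_succ]
  have h := Nat.div_add_mod' T (2 ^ (digitShift q e + 1))
  unfold IsFresh
  omega

theorem ensures_levelCmd {s : NatState 32} {n q b e T fin : ℕ} {B : ℕ → ℕ → ℕ}
    (hs : Consts n q b s) (hz : Sizes w M n q b) (he : e < q) (hes : s.reg Reg.e = e)
    (hT : s.reg Reg.task = T) (hTw : T < 2 ^ w)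
    (hd : HoldsTask b (taskAt q fin T e) s) (hB : HoldsBufs q b B s) :
    Ensures inp M levelCmd (b * 5 + 25) s fun s' =>
      HoldsTask b (taskAt q fin T (e + 1)) s' ∧
      HoldsBufs q b (fun e' o => if e' = e ∧ IsFresh q e T then 0 else B e' o) s' := by
  have hz' := hz
  obtain ⟨hM, hMw, hnw, -, -, hrows, hqq, hb, -⟩ := hz
  have hs' := hs
  obtain ⟨h0, h1, h2, h3, h4, h5, h6, h7, h8, h9, h10, h11⟩ := hs
  have hd' := hd
  obtain ⟨d1, d2, d3, d4, d5⟩ := hd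
  have hstrip := (taskAt_spec (fin := fin) (T := T) he.le).1
  have hpow : 2 ^ (e + 1) ≤ 2 ^ q := Nat.pow_le_pow_right (by omega) he
  rw [pow_succ] at hpow
  have hqb : 2 ^ q ≤ 2 ^ q * b := Nat.le_mul_of_pos_right _ hb
  have hsh : (q - e - 1) * (q + 1) = digitShift q e := by
    unfold digitShift; rw [show q - e - 1 = q - 1 - e by omega]
  have hshlt : digitShift q e + 1 < 2 ^ w := by
    rw [← hsh]
    have : (q - e - 1) * (q + 1) ≤ q * (q + 1) := Nat.mul_le_mul_right _ (by omega)
    have h2 : (q + 1) * (q + 1) = q * (q + 1) + (q + 1) := by ring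
    omega
  have haddr := bufAddr_lt (b := b) (e := e) (q := q) (o := 0) (by omega) hb
  have hy : T / 2 ^ digitShift q e / 2 * 2 ^ (digitShift q e + 1) ≤ T := by
    rw [Nat.div_div_eq_div_mul, ← pow_succ]
    exact Nat.div_mul_le_self _ _
  have hmid : T / 2 ^ digitShift q e / 2 % 2 ^ q = midSeg q e T := by
    rw [Nat.div_div_eq_div_mul, ← pow_succ, midSeg]
  have hand : T / 2 ^ digitShift q e &&& 1 = half q e T := by
    rw [Nat.and_one_is_mod, half]
  refine ensures_block_seq (T := b * 5 + 14) (by simp; omega) ?_ ?_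
  · simp [*]
    omega
  refine Ensures.seq (T₁ := 5) (T₂ := b * 5 + 9) (Q₁ := fun s₁ =>
    s₁.reg Reg.src = (if half q e T = 1 then e * b else (taskAt q fin T e).src * b) ∧
    s₁.reg Reg.sseg = (if half q e T = 1 then midSeg q e T else (taskAt q fin T e).sseg) ∧
    s₁.reg Reg.strip = (if half q e T = 1 then 2 * (taskAt q fin T e).strip + 1
      else 2 * (taskAt q fin T e).strip) ∧ s₁.mem = s.mem) ?_ (by omega) ?_
  · refine ensures_ifEq (T := 3) le_rfl (fun h => ensures_block le_rfl ?_ ?_) fun h => ?_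
    · simp [*]; omega
    · simp [*] at h
      simp [*]
      omega
    · simp [*] at h
      simp [*]
      omega
  rintro s₁ hf₁ ⟨a1, a2, a3, a4⟩
  have f1 := hf₁ Reg.t2 rfl
  have f2 := hf₁ Reg.cur rfl
  have f3 := hf₁ Reg.diag rfl
  have f4 := hf₁ Reg.y rfl
  have f5 := hf₁ Reg.task rfl
  have f6 := hf₁ Reg.tgt rfl
  have f7 := hf₁ Reg.tseg rfl
  have f8 := hf₁ Reg.zero rfl
  have f9 := hf₁ Reg.one rfl
  have f10 := hf₁ Reg.b rfl
  simp [h0, h1, h3, h4, h5, h9, hes, hT, d3, d4, hsh, hmid, hand] at f1 f2 f3 f4 f5 f6 f7 f8 f9 f10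
  have hhalf : half q e T ≠ 1 ↔ half q e T = 0 := by unfold half; omega
  refine Ensures.seq (T₁ := 4) (T₂ := b * 5 + 5) (Q₁ := fun s₂ =>
    s₂.reg Reg.tgt = (if half q e T = 1 then (taskAt q fin T e).tgt * b else e * b) ∧
    s₂.reg Reg.tseg = (if half q e T = 1 then (taskAt q fin T e).tseg else midSeg q e T) ∧
    s₂.mem = s₁.mem) ?_ (by omega) ?_
  · refine ensures_ifEq (T := 2) le_rfl (fun h => ensures_block le_rfl ?_ ?_) fun h => ?_
    · simp
    · simp [f1, f8] at h
      simp [f2, f3, h]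
    · simp [f1, f8] at h
      have : half q e T = 1 := by by_contra h'; exact h (hhalf.1 h')
      simp [f6, f7, this]
  rintro s₂ hf₂ ⟨b1, b2, b3⟩
  have htask : ∀ s' : NatState 32, (∀ v, 14 ≤ v → v < 19 → s'.reg v = s₂.reg v) →
      HoldsTask b (taskAt q fin T (e + 1)) s' := by
    intro s' hs'
    have c1 := hf₂ Reg.src rfl
    have c2 := hf₂ Reg.sseg rfl
    have c3 := hf₂ Reg.strip rfl
    rw [a1] at c1; rw [a2] at c2; rw [a3] at c3
    rw [taskAt]
    constructor <;> rw [hs' _ (by decide) (by decide)] <;> simp only [c1, c2, c3, b1, b2] <;>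
      split_ifs <;> rfl
  have hm : s₂.mem = s.mem := by rw [b3, a4]
  have g1 := hf₂ Reg.y rfl
  have g2 := hf₂ Reg.task rfl
  have g3 := hf₂ Reg.cur rfl
  have g4 := hf₂ Reg.zero rfl
  have g5 := hf₂ Reg.one rfl
  have g6 := hf₂ Reg.b rfl
  simp [f2, f4, f5, f8, f9, f10] at g1 g2 g3 g4 g5 g6
  refine ensures_ifEq (T := b * 5 + 3) (by omega) (fun h => ?_) fun h => ?_
  · simp only [Reg.y, Reg.task, g1, g2] at h
    have hfr := (isFresh_iff he).2 h
    have haddr' := bufAddr_lt (b := b) (e := e) (q := q) (o := b - 1) (by omega) (by omega)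
    refine (ensures_clearCmd (c := e * b) (l := b) (by simp [g4]) (by simp [g5]) (by simp [g3])
      (by simp [g6]) (by simp) (by simp) (by omega) hMw le_rfl).imp le_rfl ?_
    intro s₃ hf₃ hm₃
    refine ⟨htask s₃ fun v hv hv' => hf₃ v (by revert v; decide), fun e' he' o ho => ?_⟩
    beta_reduce
    rw [hm₃, hm, hB e' he' o ho]
    have hiff : (e * b ≤ e' * b + o ∧ e' * b + o < e * b + b) ↔ e' = e := by
      constructor
      · rintro ⟨k1, k2⟩
        have := (bufAddr_inj (e := e') (e' := e) (o' := e' * b + o - e * b) ho (by omega)).1 (by omega)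
        exact this.1
      · rintro rfl
        omega
    by_cases h' : e' = e
    · rw [if_pos (hiff.2 h'), if_pos ⟨h', hfr⟩]
    · rw [if_neg (fun h'' => h' (hiff.1 h'')), if_neg (fun h'' => h' h''.1)]
  · simp only [Reg.y, Reg.task, g1, g2] at h
    have hfr := mt (isFresh_iff he).1 h
    refine ⟨htask s₂ fun _ _ _ => rfl, fun e' he' o ho => ?_⟩
    beta_reduce
    rw [hm, if_neg (fun h' => hfr h'.2)]
    exact hB e' he' o ho

/-- Decoding and executing one task. -/
def taskCmd : Cmd 32 :=
  .seq (.block [.op .mul Reg.src Reg.q1 Reg.b, .mov Reg.sseg Reg.zero, .op .mul Reg.tgt Reg.q Reg.b,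
    .mov Reg.tseg Reg.fin, .mov Reg.strip Reg.zero, .mov Reg.e Reg.zero]) <|
  .seq (.forLt Reg.e Reg.q Reg.one levelCmd) stripCmd

theorem ensures_taskCmd {s : NatState 32} {n q b T : ℕ} {mt : ℕ → ℕ → Bool}
    (hs : Consts n q b s) (hz : Sizes w M n q b) (hmt : MatchesInput inp n mt)
    (hT : s.reg Reg.task = T) (hTw : T < 2 ^ w)
    (hB : HoldsBufs q b (bufs mt n q b (n / b) T) s) :
    Ensures inp M taskCmd (q * (b * 5 + 28) + n * (b * 27 + 29) + b * 5 + 20) s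
      (HoldsBufs q b (bufs mt n q b (n / b) (T + 1))) := by
  have hz' := hz
  obtain ⟨hM, hMw, hnw, -, -, hrows, hqq, hb, -⟩ := hz
  have hs' := hs
  obtain ⟨h0, h1, h2, h3, h4, h5, h6, h7, h8, h9, h10, h11⟩ := hs
  have a1 := bufAddr_lt (b := b) (e := q) (q := q) (o := 0) (by omega) hb
  have a2 := bufAddr_lt (b := b) (e := q + 1) (q := q) (o := 0) (by omega) hb
  have hqw : q + 1 ≤ (q + 1) * (q + 1) := Nat.le_mul_of_pos_left _ (by omega)
  refine ensures_block_seq (T := q * (b * 5 + 28) + n * (b * 27 + 29) + b * 5 + 14) (by simp; omega)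
    ?_ ?_
  · simp [*]; omega
  refine Ensures.seq (T₁ := q * (b * 5 + 28) + 2) (T₂ := n * (b * 27 + 29) + b * 5 + 12)
    (Q₁ := fun s₁ => HoldsTask b (taskAt q (n / b) T q) s₁ ∧
      HoldsBufs q b (clearBufs q T (bufs mt n q b (n / b) T)) s₁) ?_ (by omega) ?_
  · refine ensures_forLt (N := q) (T := b * 5 + 25) (fun e s' =>
      HoldsTask b (taskAt q (n / b) T e) s' ∧ HoldsBufs q b (fun e' o =>
        if e' < e ∧ IsFresh q e' T then 0 else bufs mt n q b (n / b) T e' o) s')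
      (by omega) rfl rfl rfl (by simp) (by simp) (by simp [h3]) (by simp [h1]) (by simp [h0])
      (by simp [h0]) ?_ ?_ ?_
    · simp [h0]
      refine ⟨?_, fun e he o ho => ?_⟩
      · rw [taskAt]
        constructor <;> simp [*]
      · simpa using hB e he o ho
    · rintro e he s' hf hi ⟨i1, i2⟩
      have hc' : Consts n q b s' := hs'.congr fun v hv => by
        rw [hf v (by revert v; decide), reg_runPrims (by revert v; decide)]
      have hT' := hf Reg.task rfl
      simp [hT] at hT'
      refine (ensures_levelCmd hc' hz' he hi hT' hTw i1 i2).imp le_rfl ?_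
      rintro s'' - ⟨j1, j2⟩
      refine ⟨j1.congr fun v hv hv' => ?_, fun e' he' o ho => ?_⟩
      · rw [NatState.reg_set, if_neg (by revert v; decide)]
      · refine (j2 e' he' o ho).trans ?_
        by_cases h : e' = e
        · subst h
          simp
        · have : e' < e + 1 ↔ e' < e := by omega
          simp [h, this]
    · rintro s' - - ⟨i1, i2⟩
      refine ⟨i1, fun e' he' o ho => ?_⟩
      rw [i2 e' he' o ho, clearBufs]
      refine if_congr ?_ rfl rfl
      exact ⟨fun h => h.2, fun h => ⟨h.1, h⟩⟩
  · rintro s₁ hf₁ ⟨i1, i2⟩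
    have hc₁ : Consts n q b s₁ := hs'.congr fun v hv => by
      rw [hf₁ v (by revert v; decide), reg_runPrims (by revert v; decide)]
    obtain ⟨t1, t2, t3, -⟩ := taskAt_spec (fin := n / b) (T := T) (le_refl q)
    exact ensures_stripCmd hc₁ hz' hmt i1 (by omega) (by omega) taskAt_src_ne_tgt t1
      (stripTable_task_le T) i2

/-- The largest `i < k` with `2 ^ (i * i) ≤ n`, or `0` if there is none. The number of levels is
`levelCount n n`, which is about `√(log n)`. -/
def levelCount (n : ℕ) : ℕ → ℕ
  | 0 => 0
  | k + 1 => if 2 ^ (k * k) ≤ n then k else levelCount n k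

/-- The structured program; the result is left in a register. -/
def lcsCmd : Cmd 32 :=
  .seq (.block [.const Reg.one 1, .input Reg.n Reg.zero]) <|
  .seq (.forLt Reg.i Reg.n Reg.one
    (.seq (.block [.op .mul Reg.t1 Reg.i Reg.i, .op .shr Reg.t2 Reg.n Reg.t1])
      (.ifLt Reg.zero Reg.t2 (.block [.mov Reg.q Reg.i])))) <|
  .seq (.block [.op .add Reg.q1 Reg.q Reg.one, .op .shl Reg.k Reg.one Reg.q,
    .op .shr Reg.b Reg.n Reg.q, .op .add Reg.b Reg.b Reg.one, .op .add Reg.cb Reg.q1 Reg.one,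
    .op .mul Reg.cb Reg.cb Reg.b, .op .div Reg.fin Reg.n Reg.b, .op .mul Reg.t1 Reg.q Reg.q1,
    .op .shl Reg.tot Reg.one Reg.t1, .op .add Reg.b1 Reg.b Reg.one,
    .op .add Reg.n1 Reg.n Reg.one]) <|
  .seq (.forLt Reg.task Reg.tot Reg.one taskCmd) <|
  .block [.op .mul Reg.t1 Reg.q Reg.b, .op .mod Reg.t2 Reg.n Reg.b, .op .add Reg.t1 Reg.t1 Reg.t2,
    .load Reg.t1 Reg.t1]

theorem ensures_lcsCmd {n q b : ℕ} {mt : ℕ → ℕ → Bool} (hq : q = levelCount n n)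
    (hb : b = n / 2 ^ q + 1) (hz : Sizes w M n q b) (hn : inputAt inp 0 = n)
    (hmt : MatchesInput inp n mt) :
    Ensures inp M lcsCmd (2 ^ (q * (q + 1)) *
        (q * (b * 5 + 28) + n * (b * 27 + 29) + b * 5 + 23) + n * 8 + 21) ⟨fun _ => 0, fun _ => 0⟩
      fun s => s.reg Reg.t1 = lcsTable mt (2 ^ q * b) n := by
  have hz' := hz
  obtain ⟨hM, hMw, hnw, hnn, htot, hrows, hqq, hb0, hnb⟩ := hz
  have hqw : q + 1 ≤ (q + 1) * (q + 1) := Nat.le_mul_of_pos_left _ (by omega)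
  have hqqe : (q + 1) * (q + 1) = q * (q + 1) + (q + 1) := by ring
  set Tt := 2 ^ (q * (q + 1)) * (q * (b * 5 + 28) + n * (b * 27 + 29) + b * 5 + 23) with hTt
  refine ensures_block_seq (T := Tt + n * 8 + 19) (by simp; omega)
    ⟨show 1 < 2 ^ w by omega, trivial, trivial⟩ ?_
  refine Ensures.seq (T₁ := n * 8 + 2) (T₂ := Tt + 17) (Q₁ := fun s₁ =>
    s₁.reg Reg.zero = 0 ∧ s₁.reg Reg.one = 1 ∧ s₁.reg Reg.n = n ∧ s₁.reg Reg.q = q ∧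
    s₁.reg Reg.task = 0 ∧ ∀ a, s₁.mem a = 0) ?_ (by omega) ?_
  · refine ensures_forLt (N := n) (T := 5) (fun k s' =>
      s'.reg Reg.q = levelCount n k ∧ ∀ a, s'.mem a = 0) (by omega) rfl rfl rfl (by simp) (by simp)
      (by simp [hn]) (by simp) (by simp) (by simp) ?_ ?_ ?_
    · simp [levelCount]
    · rintro k hk s' hf hi ⟨i1, i2⟩
      have e0 := hf Reg.zero rfl
      have e1 := hf Reg.n rfl
      simp [hn] at e0 e1 hi i1
      have hkk : k * k < 2 ^ w := (Nat.mul_le_mul hk.le hk.le).trans_lt hnn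
      have hiff : 0 < n / 2 ^ (k * k) ↔ 2 ^ (k * k) ≤ n := Nat.div_pos_iff.trans (by simp)
      refine ensures_block_seq (T := 3) (by simp) (by simp [hi, hkk]) ?_
      refine ensures_ifLt (T := 1) le_rfl (fun h => ensures_block le_rfl (by simp) ?_) fun h => ?_
      · simp [e0, e1, hi, -Nat.div_pos_iff] at h
        simp [i2, levelCount, hi, hiff.1 h]
      · simp [e0, e1, hi] at h
        have h' : ¬ 2 ^ (k * k) ≤ n := by omega
        simp [i2, i1, levelCount, h']
    · rintro s' hf hi ⟨i1, i2⟩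
      have e0 := hf Reg.zero rfl
      have e1 := hf Reg.one rfl
      have e2 := hf Reg.n rfl
      have e3 := hf Reg.task rfl
      simp [hn] at e0 e1 e2 e3
      exact ⟨e0, e1, e2, by rw [i1, hq], e3, i2⟩
  rintro s₁ - ⟨a0, a1, a2, a3, a4, a5⟩
  simp at a0 a1 a2 a3 a4
  have hqp : q < 2 ^ q := Nat.lt_two_pow_self
  have hqb : 2 ^ q ≤ 2 ^ q * b := Nat.le_mul_of_pos_right _ hb0
  have hdiv : n / 2 ^ q ≤ n := Nat.div_le_self _ _
  refine ensures_block_seq (T := Tt + 6) (by simp; omega) ?_ ?_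
  · simp [a1, a2, a3, ← hb]
    have k1 : b ≤ 2 ^ q * b := Nat.le_mul_of_pos_left _ (by omega)
    have k2 : q + 2 ≤ (q + 2) * b := Nat.le_mul_of_pos_right _ hb0
    have k3 : q + 1 + 1 = q + 2 := rfl
    rw [k3]
    exact ⟨by omega, by omega, by omega, by omega, by omega, by omega, htot, by omega, by omega⟩
  set s₂ := runPrims inp _ s₁ with hs₂
  have hc₂ : Consts n q b s₂ := by
    constructor <;> simp [hs₂, a0, a1, a2, a3, ← hb]
  have hT₂ : s₂.reg Reg.task = 0 := by simp [hs₂, a4]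
  have hm₂ : ∀ a, s₂.mem a = 0 := by simp [hs₂, a5]
  clear_value s₂
  refine Ensures.seq (T₁ := Tt + 2) (T₂ := 4) (Q₁ := fun s₃ =>
    HoldsBufs q b (bufs mt n q b (n / b) (2 ^ (q * (q + 1)))) s₃) ?_ le_rfl ?_
  · refine ensures_forLt (N := 2 ^ (q * (q + 1)))
      (T := q * (b * 5 + 28) + n * (b * 27 + 29) + b * 5 + 20) (fun k s' =>
      HoldsBufs q b (bufs mt n q b (n / b) k) s') htot rfl rfl rfl (by simp) (by simp)
      hc₂.reg_tot hc₂.reg_one (hT₂.le.trans (Nat.zero_le _)) ?_ ?_ ?_ ?_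
    · rw [hT₂, Nat.sub_zero, hTt]
    · intro e he o ho
      rw [hm₂, hT₂]
      rfl
    · intro k hk s' hf hi hI
      have hc' : Consts n q b s' := hc₂.congr fun v hv => hf v (by revert v; decide)
      refine (ensures_taskCmd hc' hz' hmt hi (hk.trans htot) hI).imp le_rfl ?_
      intro s'' _ hs'' e he o ho
      exact hs'' e he o ho
    · intro s' _ _ hI
      exact hI
  · intro s₃ hf₃ hB₃
    have hc₃ : Consts n q b s₃ := hc₂.congr fun v hv => hf₃ v (by revert v; decide)
    have hmod : n % b < b := Nat.mod_lt _ hb0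
    have haddr := bufAddr_lt (e := q) (q := q) (by omega) hmod
    refine ensures_block le_rfl ?_ ?_
    · simp [hc₃.reg_q, hc₃.reg_b, hc₃.reg_n]
      omega
    · simp [hc₃.reg_q, hc₃.reg_b, hc₃.reg_n]
      rw [hB₃ q (by omega) _ hmod, bufs_final hnb rfl]

/-! ### Sizes, time and space -/

theorem levelCount_spec (n k : ℕ) : (levelCount n k = 0 ∨ 2 ^ (levelCount n k * levelCount n k) ≤ n) ∧
    ∀ i < k, 2 ^ (i * i) ≤ n → i ≤ levelCount n k := by
  induction k with
  | zero => simp [levelCount]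
  | succ k ih =>
    rw [levelCount]
    split_ifs with h
    · exact ⟨Or.inr h, fun i hi _ => by omega⟩
    · refine ⟨ih.1, fun i hi h' => ?_⟩
      rcases Nat.lt_succ_iff_lt_or_eq.1 hi with hi | rfl
      · exact ih.2 i hi h'
      · exact absurd h' h

theorem two_pow_levelCount_le {n : ℕ} (hn : 1 ≤ n) :
    2 ^ (levelCount n n * levelCount n n) ≤ n := by
  rcases (levelCount_spec n n).1 with h | h
  · simpa [h] using hn
  · exact h

theorem lt_two_pow_levelCount_succ (n : ℕ) :
    n < 2 ^ ((levelCount n n + 1) * (levelCount n n + 1)) := by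
  by_contra! h
  have h1 : levelCount n n + 1 < n := by
    refine lt_of_lt_of_le ?_ h
    exact (Nat.le_mul_of_pos_left _ (by omega)).trans_lt Nat.lt_two_pow_self
  have := (levelCount_spec n n).2 _ h1 h
  omega

/-- The width of the segments and the height of the strips. -/
def segWidth (n : ℕ) : ℕ := n / 2 ^ levelCount n n + 1

/-- The number of cells of the work memory that the program may access. -/
def memSize (n : ℕ) : ℕ := (levelCount n n + 2) * segWidth n + (segWidth n + 1)

/-- The bounds for the word size hold because all numbers in question are below the eighth power of
`2 ^ (log n + 1)`. -/
theorem sizes {n w : ℕ} (hw : 8 * (Nat.log 2 n + 1) ≤ w) :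
    Sizes w (memSize n) n (levelCount n n) (segWidth n) := by
  have hlog : n < 2 ^ (Nat.log 2 n + 1) := Nat.lt_pow_succ_log_self (by omega) n
  have hqq : levelCount n n * levelCount n n ≤ Nat.log 2 n := by
    rcases Nat.eq_zero_or_pos n with rfl | hn
    · simp [levelCount]
    · exact Nat.le_log_of_pow_le (by omega) (two_pow_levelCount_le hn)
  set q := levelCount n n with hq
  set l := Nat.log 2 n with hl
  set m := 2 ^ (l + 1) with hm
  have hlm : l + 1 < m := Nat.lt_two_pow_self
  have hm2 : 2 ≤ m := by omega
  have hq1 : q ≤ q * q := Nat.le_mul_self q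
  have hb : segWidth n ≤ m := by
    have : n / 2 ^ q ≤ n := Nat.div_le_self _ _
    unfold segWidth
    rw [← hq]
    omega
  have hb0 : 0 < segWidth n := Nat.succ_pos _
  set b := segWidth n with hbdef
  have hmw : m ^ 8 ≤ 2 ^ w := by
    rw [hm, ← pow_mul]
    exact Nat.pow_le_pow_right (by omega) (by omega)
  have hm3 : m ^ 3 < m ^ 8 := Nat.pow_lt_pow_right (by omega) (by omega)
  have hm24 : m ^ 2 + 1 ≤ m ^ 3 := by
    have : 1 ≤ m ^ 2 := Nat.one_le_pow _ _ (by omega)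
    calc m ^ 2 + 1 ≤ m ^ 2 * 2 := by omega
      _ ≤ m ^ 2 * m := Nat.mul_le_mul_left _ hm2
      _ = m ^ 3 := by ring
  have hm12 : 2 * m ≤ m ^ 2 := by rw [pow_two]; exact Nat.mul_le_mul_right _ hm2
  have hKm : 2 ^ q ≤ m := Nat.pow_le_pow_right (by omega) (by omega)
  refine ⟨by rw [memSize], ?_, by omega, ?_, ?_, ?_, ?_, hb0, ?_⟩
  · have h1 : (q + 3) * b ≤ (2 * m) * m := Nat.mul_le_mul (by omega) hb
    have h2 : memSize n = (q + 3) * b + 1 := by rw [memSize]; ring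
    have h3 : m ^ 3 * 2 ≤ m ^ 4 := by
      rw [pow_succ m 3]; exact Nat.mul_le_mul_left _ hm2
    have h4 : m ^ 4 < m ^ 8 := Nat.pow_lt_pow_right (by omega) (by omega)
    have h5 : 2 * m * m = 2 * m ^ 2 := by ring
    omega
  · have : n * n ≤ m * m := Nat.mul_le_mul hlog.le hlog.le
    rw [← pow_two m] at this
    omega
  · have h1 : 2 ^ (q * (q + 1)) ≤ m ^ 2 := by
      rw [hm, ← pow_mul]
      refine Nat.pow_le_pow_right (by omega) ?_
      rw [Nat.mul_succ]; omega
    omega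
  · have := Nat.mul_le_mul hKm hb
    rw [← pow_two m] at this
    omega
  · have := Nat.mul_le_mul (show q + 1 ≤ m by omega) (show q + 1 ≤ m by omega)
    rw [← pow_two m] at this
    omega
  · rw [hbdef, segWidth, ← hq]
    exact Nat.lt_mul_div_succ n (by positivity)

theorem two_pow_mul_segWidth_le {n : ℕ} (hn : 1 ≤ n) :
    2 ^ levelCount n n * segWidth n ≤ 2 * n := by
  have h1 := two_pow_levelCount_le hn
  have h2 : 2 ^ levelCount n n ≤ 2 ^ (levelCount n n * levelCount n n) :=
    Nat.pow_le_pow_right (by omega) (Nat.le_mul_self _)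
  have h3 : 2 ^ levelCount n n * (n / 2 ^ levelCount n n) ≤ n := Nat.mul_div_le _ _
  rw [segWidth, Nat.mul_succ]
  omega

/-- There are `2 ^ (q * (q + 1)) ≤ n * 2 ^ q` tasks of `O(n * b)` steps each, and
`2 ^ q * b ≤ 2 * n`. -/
theorem time_le {n q b : ℕ} (hn : 1 ≤ n) (hq : q = levelCount n n) (hb : b = segWidth n) :
    2 ^ (q * (q + 1)) * (q * (b * 5 + 28) + n * (b * 27 + 29) + b * 5 + 23) + n * 8 + 21 + 1 ≤
      264 * n ^ 3 := by
  have hb0 : 1 ≤ b := by rw [hb]; exact Nat.succ_pos _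
  have hKb : 2 ^ q * b ≤ 2 * n := by rw [hq, hb]; exact two_pow_mul_segWidth_le hn
  have hqn := two_pow_levelCount_le hn
  rw [← hq] at hqn
  have hqn' : q ≤ n :=
    ((Nat.le_mul_self q).trans Nat.lt_two_pow_self.le).trans hqn
  have hnb : 1 ≤ n * b := Nat.mul_pos hn hb0
  have h1 : n ≤ n * b := Nat.le_mul_of_pos_right _ hb0
  have h2 : b ≤ n * b := Nat.le_mul_of_pos_left _ hn
  have h3 : q * b ≤ n * b := Nat.mul_le_mul_right _ hqn'
  have h4 : q * (b * 5 + 28) + n * (b * 27 + 29) + b * 5 + 23 ≤ 117 * (n * b) := by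
    have e1 : q * (b * 5 + 28) = 5 * (q * b) + 28 * q := by ring
    have e2 : n * (b * 27 + 29) = 27 * (n * b) + 29 * n := by ring
    omega
  have h5 : 2 ^ (q * (q + 1)) ≤ n * 2 ^ q := by
    rw [Nat.mul_succ, pow_add]
    exact Nat.mul_le_mul_right _ hqn
  have h6 : 2 ^ (q * (q + 1)) * (q * (b * 5 + 28) + n * (b * 27 + 29) + b * 5 + 23) ≤
      234 * n ^ 3 := by
    calc _ ≤ (n * 2 ^ q) * (117 * (n * b)) := Nat.mul_le_mul h5 h4
      _ = 117 * n * n * (2 ^ q * b) := by ring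
      _ ≤ 117 * n * n * (2 * n) := Nat.mul_le_mul_left _ hKb
      _ = 234 * n ^ 3 := by ring
  have h7 : n ≤ n ^ 3 := Nat.le_self_pow (by omega) n
  omega

/-- The space bound without real powers of the logarithm. -/
theorem spaceBound_eq (n : ℕ) : spaceBound n =
    n * (Real.logb 2 n * √(Real.logb 2 n)) / 2 ^ √(Real.logb 2 n) := by
  have hx : 0 ≤ Real.logb 2 n := by
    rcases Nat.eq_zero_or_pos n with rfl | hn
    · simp
    · exact Real.logb_nonneg (by norm_num) (by exact_mod_cast hn)
  rw [spaceBound, show (1.5 : ℝ) = 1 + 1 / 2 by norm_num, Real.rpow_add' hx (by norm_num),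
    Real.rpow_one, Real.sqrt_eq_rpow]

/-- There are `O(q * b)` words of `O(log n)` bits, and `q ≤ √(log n) ≤ q + 1` turns
`b ≤ 2 * n / 2 ^ q` into `b ≤ 4 * n / 2 ^ √(log n)`. -/
theorem space_le {n w c : ℕ} (hn : 2 ≤ n) (hw : w ≤ c * (Nat.log 2 n + 1)) :
    ((w * (32 + memSize n) : ℕ) : ℝ) ≤ 296 * c * spaceBound n := by
  set q := levelCount n n with hq
  set x := Real.logb 2 n with hx
  have hn0 : (0 : ℝ) < n := by exact_mod_cast (by omega : 0 < n)
  have hlog : (Nat.log 2 n : ℝ) ≤ x := Real.natLog_le_logb n 2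
  have hx1 : 1 ≤ x := by
    rw [hx, Real.le_logb_iff_rpow_le (by norm_num) hn0, Real.rpow_one]
    exact_mod_cast hn
  have hy1 : 1 ≤ √x := Real.one_le_sqrt.2 hx1
  have hqy : (q : ℝ) ≤ √x := by
    refine Real.le_sqrt_of_sq_le (le_trans ?_ hlog)
    have := Nat.le_log_of_pow_le (b := 2) (by omega) (two_pow_levelCount_le (n := n) (by omega))
    rw [pow_two]
    exact_mod_cast this
  have hyq : √x ≤ q + 1 := by
    refine Real.sqrt_le_iff.2 ⟨by positivity, ?_⟩
    rw [hx, Real.logb_le_iff_le_rpow (by norm_num) hn0]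
    have := (lt_two_pow_levelCount_succ n).le
    rw [← hq, ← pow_two] at this
    calc (n : ℝ) ≤ ((2 ^ (q + 1) ^ 2 : ℕ) : ℝ) := by exact_mod_cast this
      _ = 2 ^ (((q : ℝ) + 1) ^ 2) := by
        rw [show ((q : ℝ) + 1) ^ 2 = (((q + 1) ^ 2 : ℕ) : ℝ) by push_cast; ring,
          Real.rpow_natCast]
        push_cast; ring
  have hpow : (2 : ℝ) ^ √x ≤ 2 * 2 ^ q := by
    calc (2 : ℝ) ^ √x ≤ 2 ^ ((q : ℝ) + 1) := Real.rpow_le_rpow_of_exponent_le (by norm_num) hyq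
      _ = 2 * 2 ^ q := by
        rw [Real.rpow_add (by norm_num), Real.rpow_natCast, Real.rpow_one, mul_comm]
  have hpos : (0 : ℝ) < 2 ^ √x := by positivity
  have hb : (segWidth n : ℝ) ≤ 4 * n / 2 ^ √x := by
    rw [le_div_iff₀ hpos]
    have h1 : ((2 ^ q * segWidth n : ℕ) : ℝ) ≤ ((2 * n : ℕ) : ℝ) := by
      exact_mod_cast two_pow_mul_segWidth_le (n := n) (by omega)
    push_cast at h1
    have h2 := mul_le_mul_of_nonneg_left hpow (Nat.cast_nonneg (α := ℝ) (segWidth n))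
    linarith
  have hM : ((32 + memSize n : ℕ) : ℝ) ≤ 37 * √x * segWidth n := by
    have hb1 : (1 : ℝ) ≤ segWidth n := by
      exact_mod_cast Nat.succ_pos (n / 2 ^ levelCount n n)
    rw [memSize, ← hq]
    push_cast
    have h1 : (q : ℝ) + 36 ≤ 37 * √x := by linarith
    have h2 := mul_le_mul_of_nonneg_right h1 (zero_le_one.trans hb1)
    linarith
  have hw' : (w : ℝ) ≤ 2 * c * x := by
    have h1 : (w : ℝ) ≤ c * (Nat.log 2 n + 1) := by exact_mod_cast hw
    have h2 : (c : ℝ) * (Nat.log 2 n + 1) ≤ c * (2 * x) :=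
      mul_le_mul_of_nonneg_left (by linarith) (Nat.cast_nonneg c)
    linarith
  rw [spaceBound_eq, ← hx]
  calc ((w * (32 + memSize n) : ℕ) : ℝ) = w * ((32 + memSize n : ℕ) : ℝ) := by push_cast; ring
    _ ≤ (2 * c * x) * (37 * √x * (4 * n / 2 ^ √x)) := by
      refine mul_le_mul hw' (hM.trans ?_) (Nat.cast_nonneg _) (by positivity)
      exact mul_le_mul_of_nonneg_left hb (by positivity)
    _ = 296 * c * (n * (x * √x) / 2 ^ √x) := by ring

theorem spaceBound_nonneg (n : ℕ) : 0 ≤ spaceBound n := by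
  rw [spaceBound_eq]
  rcases Nat.eq_zero_or_pos n with rfl | hn
  · simp
  · have : 0 ≤ Real.logb 2 n := Real.logb_nonneg (by norm_num) (by exact_mod_cast hn)
    positivity

theorem isLittleO_spaceBound : spaceBound =o[atTop] (fun n : ℕ => (n : ℝ)) := by
  have hy : Tendsto (fun n : ℕ => √(Real.logb 2 n)) atTop atTop :=
    Real.tendsto_sqrt_atTop.comp
      ((Real.tendsto_logb_atTop (by norm_num)).comp tendsto_natCast_atTop_atTop)
  have h0 := (tendsto_rpow_mul_exp_neg_mul_atTop_nhds_zero 3 (Real.log 2)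
    (Real.log_pos (by norm_num))).comp hy
  have h1 := (isBigO_refl (fun n : ℕ => (n : ℝ)) atTop).mul_isLittleO
    ((isLittleO_one_iff ℝ).2 h0)
  refine h1.congr' ?_ (by simp)
  filter_upwards [eventually_ge_atTop 1] with n hn
  have hx : 0 ≤ Real.logb 2 n := Real.logb_nonneg (by norm_num) (by exact_mod_cast hn)
  simp only [Function.comp]
  rw [spaceBound_eq, mul_div_assoc, neg_mul, Real.exp_neg, Real.rpow_def_of_pos (x := 2) (by norm_num),
    div_eq_mul_inv, show (3 : ℝ) = ((3 : ℕ) : ℝ) by norm_num, Real.rpow_natCast, pow_succ,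
    Real.sq_sqrt hx]

/-! ### The machine program -/

/-- The program that computes the length of a longest common subsequence. -/
def lcsProgram : Program where
  numRegs := 32
  code := lcsCmd.compile 0 ++ [.output Reg.t1]

theorem matchesInput_encode {w n : ℕ} {X Y : List (BitVec w)} (hX : X.length = n)
    (hY : Y.length = n) : MatchesInput (encode n X Y) n (symbolMatch X Y) := by
  intro r j
  simp only [symbolMatch, decide_eq_true_eq, hX, hY]
  refine and_congr_right fun hr => and_congr_right fun hj => ?_
  have h1 : inputAt (encode n X Y) (r + 1) = (X[r]'(by omega)).toNat := by
    simp [inputAt, encode, List.getElem?_append, hX, hr]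
  have h2 : inputAt (encode n X Y) (n + (j + 1)) = (Y[j]'(by omega)).toNat := by
    rw [← Nat.add_assoc]
    simp [inputAt, encode, hX, hY, hj]
  rw [h1, h2, List.getElem?_eq_getElem (by omega), List.getElem?_eq_getElem (by omega),
    Option.some_inj, BitVec.toNat_inj]

theorem lcsProgram_spec {w n : ℕ} (hw : 8 * (Nat.log 2 n + 1) ≤ w) {X Y : List (BitVec w)}
    (hX : X.length = n) (hY : Y.length = n) : ∃ t k : ℕ,
      lcsProgram.Halted (lcsProgram.run (encode n X Y) t) ∧
      (lcsProgram.run (encode n X Y) t).out.map BitVec.toNat = [k] ∧ IsLCSLength X Y k ∧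
      (1 ≤ n → t ≤ 264 * n ^ 3) ∧
      lcsProgram.bits (lcsProgram.run (encode n X Y) t) ≤ w * (32 + memSize n) := by
  have hz := sizes hw
  have hn0 : inputAt (encode n X Y) 0 = n := by
    have : n < 2 ^ w := by have := hz.hn; omega
    simp [inputAt, encode, Nat.mod_eq_of_lt this]
  obtain ⟨t, ht, s, hs, hres⟩ :=
    ensures_lcsCmd rfl rfl hz hn0 (matchesInput_encode hX hY)
  have hcode : CodeAt (lcsCmd.compile 0 ++ [.output Reg.t1]) 0
      (lcsCmd.compile 0 ++ [.output Reg.t1]) := by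
    intro i hi
    rw [Nat.zero_add]
    exact List.getElem?_eq_getElem hi
  rw [codeAt_append, codeAt_cons, Cmd.length_compile, Nat.zero_add] at hcode
  have hout : lcsProgram.code[lcsCmd.size]? = some (.output Reg.t1) := hcode.2.1
  obtain ⟨h1, h2, h3⟩ := Exec.iterate_step (P := lcsProgram) hs
    (cfg := Config.init lcsProgram.numRegs w) hcode.1 rfl
    ⟨fun _ => by simp [Config.init], fun _ => by simp [Config.init], by simp [Config.init]⟩
  set cfg := (lcsProgram.step (encode n X Y))^[t] (Config.init lcsProgram.numRegs w) with hcfg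
  rw [Nat.zero_add] at h2
  have hrun : lcsProgram.run (encode n X Y) (t + 1) =
      (Instr.output Reg.t1).exec (encode n X Y) cfg := by
    rw [Program.run, Function.iterate_succ_apply', ← hcfg]
    have h : lcsProgram.code[cfg.pc]? = some (.output Reg.t1) := by rw [h2]; exact hout
    exact Program.step_eq_exec h
  refine ⟨t + 1, s.reg Reg.t1, ?_, ?_, ?_, fun hn => ?_, ?_⟩
  · rw [hrun, Program.Halted]
    change (lcsCmd.compile 0 ++ [Instr.output Reg.t1]).length ≤ cfg.pc + 1
    rw [h2, List.length_append, Cmd.length_compile, List.length_singleton]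
    exact le_rfl
  · rw [hrun]
    change (cfg.out ++ [cfg.reg Reg.t1]).map BitVec.toNat = _
    rw [h3]
    exact congrArg (fun x => [x]) (h1.reg Reg.t1)
  · rw [hres]
    exact isLCSLength_lcsTable X Y (by rw [hX]; exact hz.hnb.le) hY.le
  · exact (Nat.succ_le_succ ht).trans (time_le hn rfl rfl)
  · rw [hrun]
    exact Nat.mul_le_mul_left _ (Nat.add_le_add_left h1.used _)

end WordRAM

theorem theorem1 :
    (∃ (P : WordRAM.Program) (c₀ : ℕ), 1 ≤ c₀ ∧ ∀ c : ℕ, ∃ C : ℝ, ∀ n w : ℕ,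
      c₀ * (Nat.log 2 n + 1) ≤ w → w ≤ c * (Nat.log 2 n + 1) →
      ∀ X Y : List (BitVec w), X.length = n → Y.length = n →
        ∃ t k : ℕ,
          P.Halted (P.run (WordRAM.encode n X Y) t) ∧
          (P.run (WordRAM.encode n X Y) t).out.map BitVec.toNat = [k] ∧
          IsLCSLength X Y k ∧
          (2 ≤ n →
            (t : ℝ) ≤ C * (n : ℝ) ^ 3 ∧
            (P.bits (P.run (WordRAM.encode n X Y) t) : ℝ) ≤ C * spaceBound n)) ∧
    spaceBound =o[atTop] (fun n : ℕ => (n : ℝ)) := by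
  refine ⟨⟨WordRAM.lcsProgram, 8, by norm_num, fun c => ⟨264 + 296 * c, ?_⟩⟩,
    WordRAM.isLittleO_spaceBound⟩
  intro n w hw hwc X Y hX hY
  obtain ⟨t, k, h1, h2, h3, h4, h5⟩ := WordRAM.lcsProgram_spec hw hX hY
  refine ⟨t, k, h1, h2, h3, fun hn => ⟨?_, ?_⟩⟩
  · have h : (t : ℝ) ≤ 264 * (n : ℝ) ^ 3 := by exact_mod_cast h4 (by omega)
    have h' : 0 ≤ 296 * (c : ℝ) * (n : ℝ) ^ 3 := by positivity
    linarith
  · have h : (WordRAM.lcsProgram.bits (WordRAM.lcsProgram.run (WordRAM.encode n X Y) t) : ℝ) ≤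
        ((w * (32 + WordRAM.memSize n) : ℕ) : ℝ) := by exact_mod_cast h5
    have h' := WordRAM.space_le hn hwc
    have h'' := WordRAM.spaceBound_nonneg n
    linarith
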